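/- Let $\mathbb K\in\{\mathbb R,\mathbb C\}$; all algebras and Banach spaces are over $\mathbb K$, and $B(X)$ denotes the bounded linear operators on $X$. A Banach algebra dynamical system $(A,G,\alpha)$ consists of a Banach algebra $A$, a locally compact Hausdorff group $G$ and a strongly continuous representation $\alpha:G\to\mathrm{Aut}(A)$ by bounded algebra automorphisms. A weight on $G$ is a non-zero, submultiplicative, Borel measurable function $\omega:G\to[0,\infty)$. If $\alpha$ is uniformly bounded, i.e. $\sup_{r\in G}\|\alpha_r\|<\infty$, and $\mu_G$ is a fixed left Haar measure, then $L^1(G,A,\omega;\alpha)$ denotes the completion of the space $C_c(G,A)$ of continuous compactly supported functions in the norm $\|f\|_{1,\omega}=\int_G\|f(r)\|\,\omega(r)\,d\mu_G(r)$, with the continuous multiplication extending the twisted convolution $[f*g](s)=\int_G f(r)\,\alpha_r(g(r^{-1}s))\,d\mu_G(r)$. A (anti-)representation $T$ of an algebra $E$ on $X$ is a linear (anti-)multiplicative map $T:E\to B(X)$; it is non-degenerate if the span of $T(E)X$ is dense in $X$. (Anti-)representations $U$ of a group satisfy $U_e=\mathrm{id}_X$. Two maps into $B(X)$ commute if each value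 of the one commutes with each value of the other; pairs $(\pi_1,U_1)$ and $(\pi_2,U_2)$ commute if each of $\pi_1,U_1$ commutes with each of $\pi_2,U_2$. **Theorem.** Let $(A,G,\alpha)$ and $(B,H,\beta)$ be Banach algebra dynamical systems, where $A$ and $B$ have bounded two-sided approximate identities and $\alpha$ and $\beta$ are uniformly bounded. Let $\omega$ be a weight on $G$, $\eta$ a weight on $H$, and $X$ a Banach space. Consider pairs $(\pi^m,U^m)$ and $(\pi^a,U^a)$ with the following properties. * $\pi^m:A\to B(X)$ is a non-degenerate bounded representation, $U^m:G\to B(X)$ is a strongly continuous representation, $U^m_r\pi^m(a)(U^m_r)^{-1}=\pi^m(\alpha_r(a))$ for all $a\in A$, $r\in G$, and there is a constant $C_{U^m}$ with $\|U^m_r\|\le C_{U^m}\,\omega(r)$ for all $r\in G$. * $\pi^a:B\to B(X)$ is a non-degenerate bounded anti-representation, $U^a:H\to B(X)$ is a strongly continuous anti-representation, $U^a_s\pi^a(b)(U^a_s)^{-1}=\pi^a(\beta_{s^{-1}}(b))$ for all $b\in B$, $s\in H$, and there is a constant $C_{U^a}$ with $\|U^a_s\|\le C_{U^a}\,\eta(s)$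 for all $s\in H$. (1) If, in addition, $(\pi^m,U^m)$ and $(\pi^a,U^a)$ commute, then $$T^m(f)=\int_G\pi^m(f(r))\,U^m_r\,d\mu_G(r)\quad(f\in C_c(G,A))$$ (a strong operator integral) determines a unique bounded linear map $T^m:L^1(G,A,\omega;\alpha)\to B(X)$, and $$T^a(g)=\int_H U^a_s\,\pi^a(g(s))\,d\mu_H(s)\quad(g\in C_c(H,B))$$ determines a unique bounded linear map $T^a:L^1(H,B,\eta;\beta)\to B(X)$. Moreover, $T^m$ is a non-degenerate bounded representation, $T^a$ is a non-degenerate bounded anti-representation, and $T^m$ and $T^a$ commute. (2) Conversely, let $T^m$ be a non-degenerate bounded representation of $L^1(G,A,\omega;\alpha)$ on $X$ and $T^a$ a non-degenerate bounded anti-representation of $L^1(H,B,\eta;\beta)$ on $X$ such that $T^m$ and $T^a$ commute. Then there are a unique pair $(\pi^m,U^m)$ and a unique pair $(\pi^a,U^a)$ with the properties listed in the two bullet points above for which $T^m$ and $T^a$ are given by the formulas in (1), and these two pairs necessarily commute. (For $(A,G,\alpha)=(B,H,\beta)$ and $\omega=\eta$, this describes the non-degenerate bimodules over $L^1(G,A,\omega;\alpha)$.)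 -/

import Mathlib

open MeasureTheory Filter Topology
open scoped NNReal CompactlySupported

set_option linter.unusedSectionVars false

noncomputable section

namespace BeurlingBimodule

/-! ### Banach algebra dynamical systems, approximate identities -/

section Systems

variable (𝕜 G A : Type*) [RCLike 𝕜] [Group G] [TopologicalSpace G]
  [NonUnitalNormedRing A] [NormedSpace 𝕜 A]

/-- A Banach algebra dynamical system `(A, G, α)`: a strongly continuous representation `α` of the
topological group `G` on the Banach algebra `A` by bounded algebra automorphisms
(each `α r` is invertible with inverse `α r⁻¹`, since `α` is a monoid homomorphism on `G`). -/
structure DynamicalSystem where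
  /-- the action, `r ↦ α r` -/
  act : G →* (A →L[𝕜] A)
  act_mul : ∀ (r : G) (a b : A), act r (a * b) = act r a * act r b
  continuous_act : ∀ a : A, Continuous fun r : G => act r a

variable {𝕜 G A}

/-- `α` is uniformly bounded: `sup_r ‖α r‖ < ∞`. -/
def DynamicalSystem.UniformlyBounded (α : DynamicalSystem 𝕜 G A) : Prop :=
  ∃ C : ℝ, ∀ r : G, ‖α.act r‖ ≤ C

/-- `A` has a bounded two-sided approximate identity (a norm-bounded net, encoded by the filter of
its tails, that is an approximate identity on both sides). -/
def HasBoundedApproxIdentity (A : Type*) [NonUnitalNormedRing A] : Prop :=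
  ∃ l : Filter A, l.IsApproximateUnit ∧ ∃ M : ℝ, ∀ᶠ u in l, ‖u‖ ≤ M

theorem DynamicalSystem.continuous_uncurry (α : DynamicalSystem 𝕜 G A)
    (hα : α.UniformlyBounded) : Continuous fun p : G × A => α.act p.1 p.2 := by
  obtain ⟨C, hC⟩ := hα
  have h := continuous_prod_of_continuous_lipschitzWith
    (fun p : A × G => α.act p.2 p.1) C.toNNReal (fun a => α.continuous_act a)
    (fun r => (α.act r).lipschitz.weaken (by
      rw [← NNReal.coe_le_coe]; exact (hC r).trans (Real.le_coe_toNNReal C)))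
  exact h.comp continuous_swap

end Systems

/-! ### Weights -/

/-- A weight on `G`: a Borel measurable, submultiplicative, non-zero function `G → [0, ∞)`. -/
structure Weight (G : Type*) [Group G] [MeasurableSpace G] where
  toFun : G → ℝ≥0
  measurable_toFun : Measurable toFun
  toFun_ne_zero : toFun ≠ 0
  toFun_mul_le : ∀ r s : G, toFun (r * s) ≤ toFun r * toFun s

instance (G : Type*) [Group G] [MeasurableSpace G] : CoeFun (Weight G) fun _ => G → ℝ≥0 :=
  ⟨Weight.toFun⟩

section Beurling

variable {G : Type*} [Group G] [TopologicalSpace G] [IsTopologicalGroup G] [LocallyCompactSpace G]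
  [T2Space G] [MeasurableSpace G] [BorelSpace G]

theorem Weight.pos {G : Type*} [Group G] [MeasurableSpace G] (ω : Weight G) (s : G) : 0 < ω s := by
  obtain ⟨t, ht⟩ := Function.ne_iff.mp ω.toFun_ne_zero
  by_contra h
  have hs : ω s = 0 := le_antisymm (not_lt.mp h) zero_le
  have := ω.toFun_mul_le s (s⁻¹ * t)
  rw [mul_inv_cancel_left, hs, zero_mul] at this
  exact ht (le_antisymm this zero_le)

/-- A weight is locally bounded. -/
theorem Weight.exists_nhds_le (ω : Weight G) (μ : Measure G) [μ.IsHaarMeasure] [μ.Regular]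
    (s : G) : ∃ C : ℝ≥0, ∀ᶠ t in 𝓝 s, ω t ≤ C := by
  let K : TopologicalSpace.PositiveCompacts G := Classical.arbitrary _
  let E : ℕ → Set G := fun n => {t | ω t ≤ n} ∩ {t | ω t⁻¹ ≤ n}
  have hE : ∀ n, MeasurableSet (E n) := fun n =>
    (measurableSet_le ω.measurable_toFun measurable_const).inter
      (measurableSet_le (ω.measurable_toFun.comp measurable_inv) measurable_const)
  have hEU : ⋃ n, E n = Set.univ := by
    refine Set.eq_univ_of_forall fun t => Set.mem_iUnion.2 ?_
    obtain ⟨n, hn⟩ := exists_nat_ge (max (ω t) (ω t⁻¹))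
    exact ⟨n, (le_max_left _ _).trans hn, (le_max_right _ _).trans hn⟩
  obtain ⟨n, hn⟩ : ∃ n : ℕ, 0 < μ (interior K ∩ E n) := by
    by_contra! hcon
    simp_rw [nonpos_iff_eq_zero, ← measure_iUnion_null_iff, ← Set.inter_iUnion, hEU,
      Set.inter_univ] at hcon
    exact hcon.not_gt <| isOpen_interior.measure_pos _ K.interior_nonempty
  have hst := Measure.div_mem_nhds_one_of_haar_pos_ne_top μ (interior K ∩ E n)
    (isOpen_interior.measurableSet.inter (hE n)) hn
    (mt (measure_mono_top <| Set.inter_subset_left.trans interior_subset) K.isCompact.measure_ne_top)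
  refine ⟨ω s * (n * n), ?_⟩
  have hcont : Tendsto (fun t : G => s⁻¹ * t) (𝓝 s) (𝓝 1) := by
    have : Continuous fun t : G => s⁻¹ * t := by fun_prop
    simpa using this.tendsto s
  filter_upwards [hcont hst] with t ht
  obtain ⟨x, hx, y, hy, hxy⟩ := Set.mem_div.1 ht
  have h1 : t = s * (x * y⁻¹) := by rw [← div_eq_mul_inv, hxy]; group
  rw [h1]
  refine (ω.toFun_mul_le _ _).trans (mul_le_mul_right ((ω.toFun_mul_le _ _).trans ?_) _)
  exact mul_le_mul' hx.2.1 hy.2.2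

variable (μ : Measure G) [μ.IsHaarMeasure] [μ.Regular] (ω : Weight G)

/-- The measure `ω dμ` is finite on compact sets. -/
theorem Weight.isFiniteMeasureOnCompacts :
    IsFiniteMeasureOnCompacts (μ.withDensity fun s => (ω s : ENNReal)) := by
  refine ⟨fun K hK => ?_⟩
  refine hK.induction_on (p := fun K => (μ.withDensity fun s => (ω s : ENNReal)) K < ⊤)
    (by simp) (fun s t hst ht => (measure_mono hst).trans_lt ht)
    (fun s t hs ht => (measure_union_le s t).trans_lt (ENNReal.add_lt_top.2 ⟨hs, ht⟩)) ?_
  intro x _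
  obtain ⟨C, hC⟩ := ω.exists_nhds_le μ x
  obtain ⟨L, hL, hLx⟩ := exists_compact_mem_nhds x
  obtain ⟨V, hVsub, hV, hxV⟩ := mem_nhds_iff.1 (Filter.inter_mem hC hLx)
  refine ⟨V, mem_nhdsWithin_of_mem_nhds (hV.mem_nhds hxV), ?_⟩
  rw [withDensity_apply _ hV.measurableSet]
  calc ∫⁻ s in V, (ω s : ENNReal) ∂μ ≤ ∫⁻ _ in V, (C : ENNReal) ∂μ :=
        setLIntegral_mono measurable_const fun s hs => by
          exact_mod_cast (hVsub hs).1
    _ = C * μ V := by simp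
    _ < ⊤ := ENNReal.mul_lt_top ENNReal.coe_lt_top
        ((measure_mono fun s hs => (hVsub hs).2).trans_lt hL.measure_lt_top)

/-! ### The weighted space `L¹(G, A, ω)` -/

section Space

variable {A : Type*} [NormedAddCommGroup A]

theorem Weight.integral_mul_eq (φ : G → ℝ) :
    ∫ s, φ s * (ω s : ℝ) ∂μ = ∫ s, φ s ∂(μ.withDensity fun s => (ω s : ENNReal)) := by
  rw [integral_withDensity_eq_integral_smul ω.measurable_toFun]
  exact integral_congr_ae (.of_forall fun s => by simp [NNReal.smul_def, mul_comm])

theorem Weight.integrable_mul (φ : G → ℝ) (hφ : Continuous φ) (h : HasCompactSupport φ) :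
    Integrable (fun s => φ s * (ω s : ℝ)) μ := by
  have := ω.isFiniteMeasureOnCompacts μ
  have h1 : Integrable φ (μ.withDensity fun s => (ω s : ENNReal)) :=
    hφ.integrable_of_hasCompactSupport h
  rw [integrable_withDensity_iff_integrable_smul ω.measurable_toFun] at h1
  exact h1.congr (.of_forall fun s => by simp [NNReal.smul_def, mul_comm])

variable (A) in
/-- `C_c(G, A)` as it is normed by `‖h‖_{1, ω} = ∫ ‖h(s)‖ ω(s) dμ(s)`. -/
def WeightedCc (_μ : Measure G) (_ω : Weight G) : Type _ := C_c(G, A)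

instance : AddCommGroup (WeightedCc A μ ω) := inferInstanceAs (AddCommGroup C_c(G, A))

instance {𝕜 : Type*} [RCLike 𝕜] [NormedSpace 𝕜 A] : Module 𝕜 (WeightedCc A μ ω) :=
  inferInstanceAs (Module 𝕜 C_c(G, A))

instance : FunLike (WeightedCc A μ ω) G A := inferInstanceAs (FunLike C_c(G, A) G A)

variable {μ ω} in
theorem WeightedCc.continuous (f : WeightedCc A μ ω) : Continuous f :=
  (show C_c(G, A) from f).toContinuousMap.continuous

variable {μ ω} in
theorem WeightedCc.hasCompactSupport (f : WeightedCc A μ ω) : HasCompactSupport f :=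
  CompactlySupportedContinuousMap.hasCompactSupport' f

variable {μ ω} in
theorem WeightedCc.integrable_norm_mul (f : WeightedCc A μ ω) :
    Integrable (fun s => ‖f s‖ * (ω s : ℝ)) μ :=
  ω.integrable_mul μ _ f.continuous.norm f.hasCompactSupport.norm

instance : Norm (WeightedCc A μ ω) := ⟨fun h => ∫ s, ‖h s‖ * (ω s : ℝ) ∂μ⟩

variable {μ ω} in
theorem WeightedCc.norm_def (h : WeightedCc A μ ω) : ‖h‖ = ∫ s, ‖h s‖ * (ω s : ℝ) ∂μ := rfl

instance : NormedAddCommGroup (WeightedCc A μ ω) :=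
  AddGroupNorm.toNormedAddCommGroup
    { toFun := fun h => ‖h‖
      map_zero' := by
        rw [WeightedCc.norm_def]
        have : ∀ s, (0 : WeightedCc A μ ω) s = 0 := fun _ => rfl
        simp [this]
      add_le' := fun f g => by
        simp only [WeightedCc.norm_def]
        rw [← integral_add f.integrable_norm_mul g.integrable_norm_mul]
        refine integral_mono (f + g).integrable_norm_mul
          (f.integrable_norm_mul.add g.integrable_norm_mul) fun s => ?_
        have : (f + g) s = f s + g s := rfl
        simp only [this, ← add_mul]
        exact mul_le_mul_of_nonneg_right (norm_add_le _ _) (ω s).coe_nonneg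
      neg' := fun f => by
        simp only [WeightedCc.norm_def]
        have : ∀ s, (-f) s = -(f s) := fun _ => rfl
        simp [this]
      eq_zero_of_map_eq_zero' := fun f hf => by
        replace hf : ∫ s, ‖f s‖ * (ω s : ℝ) ∂μ = 0 := hf
        rw [integral_eq_zero_iff_of_nonneg (fun s => mul_nonneg (norm_nonneg _) (ω s).coe_nonneg)
          f.integrable_norm_mul] at hf
        have hae : (f : G → A) =ᵐ[μ] fun _ => 0 := by
          filter_upwards [hf] with s hs
          have := (mul_eq_zero.1 hs).resolve_right
            (by exact_mod_cast (ω.pos s).ne')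
          simpa using this
        have := (f.continuous.ae_eq_iff_eq μ continuous_const).1 hae
        exact DFunLike.coe_injective this }

instance {𝕜 : Type*} [RCLike 𝕜] [NormedSpace 𝕜 A] : NormedSpace 𝕜 (WeightedCc A μ ω) where
  norm_smul_le c f := by
    simp only [WeightedCc.norm_def]
    rw [← integral_const_mul]
    have : ∀ s, (c • f) s = c • f s := fun _ => rfl
    simp [this, norm_smul, mul_assoc]

/-- The Banach space `L¹(G, A, ω)`: the completion of `C_c(G, A)` in `‖·‖_{1, ω}`. -/
abbrev BeurlingSpace (A : Type*) [NormedAddCommGroup A] (μ : Measure G) [μ.IsHaarMeasure]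
    [μ.Regular] (ω : Weight G) : Type _ :=
  UniformSpace.Completion (WeightedCc A μ ω)

variable (𝕜 : Type*) [RCLike 𝕜] [NormedSpace 𝕜 A]

/-- The canonical embedding of `C_c(G, A)` in `L¹(G, A, ω)`. -/
def ofCc : WeightedCc A μ ω →L[𝕜] BeurlingSpace A μ ω := UniformSpace.Completion.toComplL

end Space

/-! ### Twisted convolution and the generalized Beurling algebra -/

section Algebra

variable {𝕜 A : Type*} [RCLike 𝕜] [NonUnitalNormedRing A] [NormedSpace ℝ A] [NormedSpace 𝕜 A]
  [IsScalarTower ℝ 𝕜 A] [IsScalarTower 𝕜 A A] [SMulCommClass 𝕜 A A] [CompleteSpace A]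

namespace DynamicalSystem

variable (α : DynamicalSystem 𝕜 G A)

theorem continuous_twist (hα : α.UniformlyBounded) {f g : G → A} (hf : Continuous f) (hg : Continuous g) :
    Continuous fun p : G × G => f p.2 * α.act p.2 (g (p.2⁻¹ * p.1)) := by
  refine (hf.comp continuous_snd).mul ?_
  exact (α.continuous_uncurry hα).comp
    (continuous_snd.prodMk (hg.comp (continuous_snd.inv.mul continuous_fst)))

theorem twist_eq_zero {f g : G → A} {s r : G} (h : ¬ (r ∈ tsupport f ∧ r⁻¹ * s ∈ tsupport g)) :
    f r * α.act r (g (r⁻¹ * s)) = 0 := by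
  rcases not_and_or.1 h with h | h
  · rw [image_eq_zero_of_notMem_tsupport h, zero_mul]
  · rw [image_eq_zero_of_notMem_tsupport h, map_zero, mul_zero]

theorem integrable_twist (hα : α.UniformlyBounded) {f g : G → A} (hf : Continuous f) (hfc : HasCompactSupport f)
    (hg : Continuous g) (s : G) :
    Integrable (fun r => f r * α.act r (g (r⁻¹ * s))) μ := by
  refine Continuous.integrable_of_hasCompactSupport
    ((α.continuous_twist hα hf hg).comp (continuous_const.prodMk continuous_id)) ?_
  exact hfc.mono fun r hr h => hr (by simp [h])

/-- Twisted convolution on `C_c(G, A)`: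
`[f * g](s) = ∫ f(r) α_r(g(r⁻¹ s)) dμ(r)`. -/
def conv (hα : α.UniformlyBounded) (f g : WeightedCc A μ ω) : WeightedCc A μ ω :=
  (⟨⟨fun s => ∫ r, f r * α.act r (g (r⁻¹ * s)) ∂μ, by
      rw [← continuousOn_univ]
      refine continuousOn_integral_of_compact_support (k := tsupport f) f.hasCompactSupport
        (α.continuous_twist hα f.continuous g.continuous).continuousOn ?_
      intro s r _ hr
      exact α.twist_eq_zero fun h => hr h.1⟩, by
      refine HasCompactSupport.intro
        (f.hasCompactSupport.isCompact.mul g.hasCompactSupport.isCompact) fun s hs => ?_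
      refine integral_eq_zero_of_ae (.of_forall fun r => ?_)
      refine α.twist_eq_zero fun h => hs ?_
      exact Set.mem_mul.2 ⟨r, h.1, r⁻¹ * s, h.2, by group⟩⟩ : C_c(G, A))

theorem conv_apply (hα : α.UniformlyBounded) (f g : WeightedCc A μ ω) (s : G) :
    α.conv μ ω hα f g s = ∫ r, f r * α.act r (g (r⁻¹ * s)) ∂μ := rfl

theorem norm_conv_le (hα : α.UniformlyBounded) {C : ℝ} (hC : ∀ r, ‖α.act r‖ ≤ C) (f g : WeightedCc A μ ω) :
    ‖α.conv μ ω hα f g‖ ≤ C * ‖f‖ * ‖g‖ := by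
  have hC0 : 0 ≤ C := (norm_nonneg _).trans (hC 1)
  have hfin := ω.isFiniteMeasureOnCompacts μ
  let ν := μ.withDensity fun s => (ω s : ENNReal)
  let Φ : G → G → ℝ := fun s r => ‖f r‖ * ‖g (r⁻¹ * s)‖
  have hΦ : Continuous Φ.uncurry :=
    (f.continuous.norm.comp continuous_snd).mul
      (g.continuous.norm.comp (continuous_snd.inv.mul continuous_fst))
  have hΦs : HasCompactSupport Φ.uncurry := by
    refine HasCompactSupport.intro
      ((f.hasCompactSupport.isCompact.mul g.hasCompactSupport.isCompact).prod
        f.hasCompactSupport.isCompact) ?_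
    rintro ⟨s, r⟩ h
    by_cases h1 : r ∈ tsupport f
    · by_cases h2 : r⁻¹ * s ∈ tsupport g
      · exact absurd ⟨Set.mem_mul.2 ⟨r, h1, r⁻¹ * s, h2, by group⟩, h1⟩ h
      · simp [Φ, Function.uncurry, image_eq_zero_of_notMem_tsupport h2]
    · simp [Φ, Function.uncurry, image_eq_zero_of_notMem_tsupport h1]
  have hΦ2 : Continuous fun s => ∫ r, Φ s r ∂μ := by
    rw [← continuousOn_univ]
    refine continuousOn_integral_of_compact_support (k := tsupport f) f.hasCompactSupport
      hΦ.continuousOn fun s r _ hr => ?_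
    simp [Φ, image_eq_zero_of_notMem_tsupport hr]
  have hΦ2s : HasCompactSupport fun s => ∫ r, Φ s r ∂μ := by
    refine HasCompactSupport.intro (hΦs.isCompact.image continuous_fst) fun s hs => ?_
    refine integral_eq_zero_of_ae (.of_forall fun r => ?_)
    exact image_eq_zero_of_notMem_tsupport (f := Φ.uncurry) fun h => hs ⟨(s, r), h, rfl⟩
  have hpt : ∀ s, ‖α.conv μ ω hα f g s‖ ≤ C * ∫ r, Φ s r ∂μ := fun s => by
    rw [conv_apply, ← integral_const_mul]
    refine norm_integral_le_of_norm_le ?_ (.of_forall fun r => ?_)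
    · refine Integrable.const_mul (Continuous.integrable_of_hasCompactSupport
        (hΦ.comp (continuous_const.prodMk continuous_id)) ?_) _
      exact f.hasCompactSupport.mono fun r hr h => hr (by simp [Φ, h])
    · calc ‖f r * α.act r (g (r⁻¹ * s))‖ ≤ ‖f r‖ * (C * ‖g (r⁻¹ * s)‖) :=
            (norm_mul_le _ _).trans (mul_le_mul_of_nonneg_left
              ((α.act r).le_of_opNorm_le (hC r) _) (norm_nonneg _))
        _ = C * Φ s r := by simp only [Φ]; ring
  calc ‖α.conv μ ω hα f g‖
      ≤ ∫ s, (C * ∫ r, Φ s r ∂μ) * (ω s : ℝ) ∂μ := by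
        rw [WeightedCc.norm_def]
        refine integral_mono (WeightedCc.integrable_norm_mul _)
          (ω.integrable_mul μ _ (hΦ2.const_mul C) (hΦ2s.mul_left)) fun s => ?_
        exact mul_le_mul_of_nonneg_right (hpt s) (ω s).coe_nonneg
    _ = C * ∫ s, ∫ r, Φ s r ∂μ ∂ν := by
        rw [ω.integral_mul_eq μ, integral_const_mul]
    _ = C * ∫ r, ∫ s, Φ s r ∂ν ∂μ := by
        rw [integral_integral_swap_of_hasCompactSupport hΦ hΦs]
    _ ≤ C * ∫ r, (‖f r‖ * (ω r : ℝ)) * ‖g‖ ∂μ := by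
        refine mul_le_mul_of_nonneg_left ?_ hC0
        refine integral_mono_of_nonneg (.of_forall fun r => integral_nonneg fun s =>
          mul_nonneg (norm_nonneg _) (norm_nonneg _)) (f.integrable_norm_mul.mul_const _)
          (.of_forall fun r => ?_)
        have hgr : Continuous fun s => ‖g (r⁻¹ * s)‖ :=
          g.continuous.norm.comp (continuous_const.mul continuous_id)
        calc ∫ s, Φ s r ∂ν = ‖f r‖ * ∫ s, ‖g (r⁻¹ * s)‖ * (ω s : ℝ) ∂μ := by
              simp only [Φ, ν]
              rw [integral_const_mul, ω.integral_mul_eq μ]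
          _ = ‖f r‖ * ∫ s, ‖g s‖ * (ω (r * s) : ℝ) ∂μ := by
              congr 1
              rw [← integral_mul_left_eq_self _ r]
              simp
          _ ≤ ‖f r‖ * ∫ s, (ω r : ℝ) * (‖g s‖ * (ω s : ℝ)) ∂μ := by
              refine mul_le_mul_of_nonneg_left ?_ (norm_nonneg _)
              refine integral_mono_of_nonneg (.of_forall fun s =>
                mul_nonneg (norm_nonneg _) (ω _).coe_nonneg) (g.integrable_norm_mul.const_mul _)
                (.of_forall fun s => ?_)
              have : (ω (r * s) : ℝ) ≤ ω r * ω s := by exact_mod_cast ω.toFun_mul_le r s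
              calc ‖g s‖ * (ω (r * s) : ℝ) ≤ ‖g s‖ * (ω r * ω s) :=
                    mul_le_mul_of_nonneg_left this (norm_nonneg _)
                _ = _ := by ring
          _ = (‖f r‖ * (ω r : ℝ)) * ‖g‖ := by
              rw [integral_const_mul, WeightedCc.norm_def]; ring
    _ = C * ‖f‖ * ‖g‖ := by
        rw [integral_mul_const, WeightedCc.norm_def f]; ring

/-- Twisted convolution as a bilinear map on `C_c(G, A)`. -/
def convₗ (hα : α.UniformlyBounded) : WeightedCc A μ ω →ₗ[𝕜] WeightedCc A μ ω →ₗ[𝕜] WeightedCc A μ ω :=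
  LinearMap.mk₂ 𝕜 (α.conv μ ω hα)
    (fun f₁ f₂ g => DFunLike.ext _ _ fun s => by
      have e : ∀ r, (f₁ + f₂) r = f₁ r + f₂ r := fun _ => rfl
      change ∫ r, (f₁ + f₂) r * α.act r (g (r⁻¹ * s)) ∂μ =
        (∫ r, f₁ r * α.act r (g (r⁻¹ * s)) ∂μ) + ∫ r, f₂ r * α.act r (g (r⁻¹ * s)) ∂μ
      rw [← integral_add
        (α.integrable_twist μ hα f₁.continuous f₁.hasCompactSupport g.continuous s)
        (α.integrable_twist μ hα f₂.continuous f₂.hasCompactSupport g.continuous s)]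
      simp only [e, add_mul])
    (fun c f g => DFunLike.ext _ _ fun s => by
      have e : ∀ r, (c • f) r = c • f r := fun _ => rfl
      change ∫ r, (c • f) r * α.act r (g (r⁻¹ * s)) ∂μ =
        c • ∫ r, f r * α.act r (g (r⁻¹ * s)) ∂μ
      rw [← integral_smul]
      simp only [e, smul_mul_assoc])
    (fun f g₁ g₂ => DFunLike.ext _ _ fun s => by
      have e : ∀ r, (g₁ + g₂) r = g₁ r + g₂ r := fun _ => rfl
      change ∫ r, f r * α.act r ((g₁ + g₂) (r⁻¹ * s)) ∂μ =
        (∫ r, f r * α.act r (g₁ (r⁻¹ * s)) ∂μ) + ∫ r, f r * α.act r (g₂ (r⁻¹ * s)) ∂μ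
      rw [← integral_add
        (α.integrable_twist μ hα f.continuous f.hasCompactSupport g₁.continuous s)
        (α.integrable_twist μ hα f.continuous f.hasCompactSupport g₂.continuous s)]
      simp only [e, map_add, mul_add])
    (fun c f g => DFunLike.ext _ _ fun s => by
      have e : ∀ r, (c • g) r = c • g r := fun _ => rfl
      change ∫ r, f r * α.act r ((c • g) (r⁻¹ * s)) ∂μ =
        c • ∫ r, f r * α.act r (g (r⁻¹ * s)) ∂μ
      rw [← integral_smul]
      simp only [e, map_smul, mul_smul_comm])

/-- Twisted convolution as a bounded bilinear map on the normed space `C_c(G, A)`. -/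
def convL (hα : α.UniformlyBounded) : WeightedCc A μ ω →L[𝕜] WeightedCc A μ ω →L[𝕜] WeightedCc A μ ω :=
  (α.convₗ μ ω hα).mkContinuous₂ hα.choose (α.norm_conv_le μ ω hα hα.choose_spec)

/-- The multiplication of the generalized Beurling algebra `L¹(G, A, ω; α)`: the extension by
continuity, in both variables, of twisted convolution on `C_c(G, A)`. -/
def beurlingMul (hα : α.UniformlyBounded) : BeurlingSpace A μ ω →L[𝕜] BeurlingSpace A μ ω →L[𝕜] BeurlingSpace A μ ω :=
  ((((ContinuousLinearMap.compL 𝕜 _ _ _ (ofCc μ ω 𝕜)).comp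
    (α.convL μ ω hα)).extend (ofCc μ ω 𝕜)).flip.extend (ofCc μ ω 𝕜)).flip

/-- The multiplication of `L¹(G, A, ω; α)` restricts to twisted convolution on `C_c(G, A)`. -/
theorem beurlingMul_ofCc (hα : α.UniformlyBounded) (f g : WeightedCc A μ ω) :
    α.beurlingMul μ ω hα (ofCc μ ω 𝕜 f) (ofCc μ ω 𝕜 g) = ofCc μ ω 𝕜 (α.conv μ ω hα f g) := by
  have hd : DenseRange (ofCc μ ω 𝕜 : WeightedCc A μ ω →L[𝕜] BeurlingSpace A μ ω) :=
    UniformSpace.Completion.denseRange_coe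
  have hu : IsUniformInducing (ofCc μ ω 𝕜 : WeightedCc A μ ω →L[𝕜] BeurlingSpace A μ ω) :=
    UniformSpace.Completion.isUniformInducing_coe _
  rw [beurlingMul, ContinuousLinearMap.flip_apply, ContinuousLinearMap.extend_eq _ hd hu,
    ContinuousLinearMap.flip_apply, ContinuousLinearMap.extend_eq _ hd hu]
  rfl

end DynamicalSystem

end Algebra

end Beurling

/-! ### Representations -/

section Representations

variable {𝕜 G A X : Type*} [RCLike 𝕜] [Group G] [TopologicalSpace G]
  [NonUnitalNormedRing A] [NormedSpace 𝕜 A] [NormedAddCommGroup X] [NormedSpace 𝕜 X]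

/-- A linear map `S : E → B(X)` is non-degenerate: the span of `S(E)X` is dense in `X`. -/
def IsNondegenerate {E : Type*} [SeminormedAddCommGroup E] [NormedSpace 𝕜 E]
    (S : E →L[𝕜] X →L[𝕜] X) : Prop :=
  Dense (Submodule.span 𝕜 {y : X | ∃ (e : E) (x : X), S e x = y} : Set X)

/-- `(π, U)` is a non-degenerate continuous covariant representation of `(A, G, α)` on `X`.
(Boundedness and linearity of `π` are in its type; `U r⁻¹` is the inverse of `U r`.) -/
structure IsCovariantRep (α : DynamicalSystem 𝕜 G A) (π : A →L[𝕜] X →L[𝕜] X)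
    (U : G → X →L[𝕜] X) : Prop where
  map_mul : ∀ a b : A, π (a * b) = π a * π b
  nondegenerate : IsNondegenerate π
  group_one : U 1 = 1
  group_mul : ∀ r s : G, U (r * s) = U r * U s
  continuous : ∀ x : X, Continuous fun r => U r x
  covariant : ∀ (a : A) (r : G), U r * π a * U r⁻¹ = π (α.act r a)

/-- `(π, U)` is a non-degenerate continuous pair of type `(a, a)` for `(A, G, α)` on `X`: `π` is a
non-degenerate bounded anti-representation, `U` is a strongly continuous anti-representation, and
`U_r π(a) U_r⁻¹ = π(α_{r⁻¹}(a))`. -/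
structure IsAntiCovariantPair (α : DynamicalSystem 𝕜 G A) (π : A →L[𝕜] X →L[𝕜] X)
    (U : G → X →L[𝕜] X) : Prop where
  map_mul : ∀ a b : A, π (a * b) = π b * π a
  nondegenerate : IsNondegenerate π
  group_one : U 1 = 1
  group_mul : ∀ r s : G, U (r * s) = U s * U r
  continuous : ∀ x : X, Continuous fun r => U r x
  anticovariant : ∀ (a : A) (r : G), U r * π a * U r⁻¹ = π (α.act r⁻¹ a)

/-- `‖U_r‖ ≤ C ω(r)` for some constant `C` and all `r`. -/
def WeightBounded [MeasurableSpace G] (U : G → X →L[𝕜] X) (ω : Weight G) : Prop :=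
  ∃ C : ℝ, ∀ r : G, ‖U r‖ ≤ C * ω r

/-- Two `B(X)`-valued maps commute. -/
def MapsCommute {S₁ S₂ : Type*} (φ₁ : S₁ → X →L[𝕜] X) (φ₂ : S₂ → X →L[𝕜] X) : Prop :=
  ∀ s₁ s₂, φ₁ s₁ * φ₂ s₂ = φ₂ s₂ * φ₁ s₁

/-- The pairs `(π₁, U₁)` and `(π₂, U₂)` commute: each of `π₁`, `U₁` commutes with each of
`π₂`, `U₂`. -/
def PairsCommute {A₁ G₁ A₂ G₂ : Type*} (π₁ : A₁ → X →L[𝕜] X) (U₁ : G₁ → X →L[𝕜] X)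
    (π₂ : A₂ → X →L[𝕜] X) (U₂ : G₂ → X →L[𝕜] X) : Prop :=
  MapsCommute π₁ π₂ ∧ MapsCommute π₁ U₂ ∧ MapsCommute U₁ π₂ ∧ MapsCommute U₁ U₂

end Representations

section BeurlingRepresentations

variable {𝕜 G A X : Type*} [RCLike 𝕜]
  [Group G] [TopologicalSpace G] [IsTopologicalGroup G] [LocallyCompactSpace G] [T2Space G]
  [MeasurableSpace G] [BorelSpace G]
  [NonUnitalNormedRing A] [NormedSpace ℝ A] [NormedSpace 𝕜 A] [IsScalarTower ℝ 𝕜 A]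
  [IsScalarTower 𝕜 A A] [SMulCommClass 𝕜 A A] [CompleteSpace A]
  [NormedAddCommGroup X] [NormedSpace 𝕜 X]
  {μ : Measure G} [μ.IsHaarMeasure] [μ.Regular] {ω : Weight G}

/-- `T` is a non-degenerate bounded representation of `L¹(G, A, ω; α)` on `X`. -/
structure IsBeurlingRep (α : DynamicalSystem 𝕜 G A) (hα : α.UniformlyBounded)
    (T : BeurlingSpace A μ ω →L[𝕜] X →L[𝕜] X) : Prop where
  map_mul : ∀ u v : BeurlingSpace A μ ω, T (α.beurlingMul μ ω hα u v) = T u * T v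
  nondegenerate : IsNondegenerate T

/-- `T` is a non-degenerate bounded anti-representation of `L¹(G, A, ω; α)` on `X`. -/
structure IsBeurlingAntiRep (α : DynamicalSystem 𝕜 G A) (hα : α.UniformlyBounded)
    (T : BeurlingSpace A μ ω →L[𝕜] X →L[𝕜] X) : Prop where
  map_mul : ∀ u v : BeurlingSpace A μ ω, T (α.beurlingMul μ ω hα u v) = T v * T u
  nondegenerate : IsNondegenerate T

variable [NormedSpace ℝ X]

/-- `T(f) = ∫ π(f(r)) U_r dμ(r)` for `f ∈ C_c(G, A)`, as a strong operator integral. -/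
def IsIntegratedForm (π : A →L[𝕜] X →L[𝕜] X) (U : G → X →L[𝕜] X)
    (T : BeurlingSpace A μ ω →L[𝕜] X →L[𝕜] X) : Prop :=
  ∀ (f : WeightedCc A μ ω) (x : X), T (ofCc μ ω 𝕜 f) x = ∫ r, π (f r) (U r x) ∂μ

/-- `T(f) = ∫ U_r π(f(r)) dμ(r)` for `f ∈ C_c(G, A)`, as a strong operator integral. -/
def IsAntiIntegratedForm (π : A →L[𝕜] X →L[𝕜] X) (U : G → X →L[𝕜] X)
    (T : BeurlingSpace A μ ω →L[𝕜] X →L[𝕜] X) : Prop :=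
  ∀ (f : WeightedCc A μ ω) (x : X), T (ofCc μ ω 𝕜 f) x = ∫ r, U r (π (f r) x) ∂μ

end BeurlingRepresentations

end BeurlingBimodule

end

/-! Everything rests on two left actions on C_c(G, A): `a` acts by pointwise multiplication and `r`
by f ↦ α_r(f(r⁻¹ ·)). Both are left centralizers of twisted convolution (`leftMul_conv`,
`translate_conv`), they satisfy the covariance relation among themselves (`translate_leftMul`), and
f * g is the integral over r of f(r) times the translate of g by r (`map_conv_eq_integral`).

If T is the integrated form of (π, U), then π(a)T(f) = T(af) and U_r T(f) = T(translate of f by r).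
Together with the integral formula for f * g this makes T multiplicative, and bumps concentrated
near the identity make it non-degenerate. Conversely, let T be non-degenerate and m a left
centralizer. A bounded left approximate identity (e) gives ∑ T(m f_i)x_i = lim T(m e) ∑ T(f_i)x_i,
so T(f)x ↦ T(m f)x is well defined and bounded (`IsNondegenerate.exists_extension`). Applied to the
two actions this produces π and U, and the integral formula shows that T is their integrated form.
Since the vectors T(f)x span a dense subspace, identities need only be checked on them: this yields
uniqueness, and shows that an operator commutes with T exactly when it commutes with π and U
(`IsIntegratedOnCc.commute_iff`).

The anti-representations need no second proof. The map f ↦ (s ↦ Δ(s) α_s(f(s⁻¹))) is an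
anti-isomorphism onto the convolution algebra of the opposite system with the weight ω(s⁻¹)
(`flat_conv`), and it matches anti-covariant pairs (π, U) with covariant pairs (π, r ↦ U_{r⁻¹}). The
cost is the substitution s ↦ s⁻¹ in Haar integrals, hence the modular function.

Commutation of the two sides follows by applying the commutation criterion once for each side, to a
single operator at a time. Density of C_c carries all this to the completion. -/

noncomputable section

namespace BeurlingBimodule

/-! ### Estimates and convergence in `C_c(G, A)` -/

section Cc

variable {G : Type*} [Group G] [TopologicalSpace G] [IsTopologicalGroup G] [LocallyCompactSpace G]
  [T2Space G] [MeasurableSpace G] [BorelSpace G]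
  (μ : Measure G) [μ.IsHaarMeasure] [μ.Regular] (ω : Weight G)
  {A B : Type*} [NormedAddCommGroup A] [NormedAddCommGroup B]

/-- A continuous compactly supported function as an element of `WeightedCc`. -/
def WeightedCc.mk (f : G → A) (hf : Continuous f) (hs : HasCompactSupport f) : WeightedCc A μ ω :=
  (⟨⟨f, hf⟩, hs⟩ : C_c(G, A))

@[simp] theorem WeightedCc.mk_apply (f : G → A) (hf : Continuous f) (hs : HasCompactSupport f)
    (s : G) : WeightedCc.mk μ ω f hf hs s = f s := rfl

variable {μ ω}

theorem WeightedCc.ext {f g : WeightedCc A μ ω} (h : ∀ s, f s = g s) : f = g :=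
  DFunLike.ext _ _ h

@[simp] theorem WeightedCc.add_apply (f g : WeightedCc A μ ω) (s : G) :
    (f + g) s = f s + g s := rfl

@[simp] theorem WeightedCc.sub_apply (f g : WeightedCc A μ ω) (s : G) :
    (f - g) s = f s - g s := rfl

@[simp] theorem WeightedCc.smul_apply {𝕜 : Type*} [RCLike 𝕜] [NormedSpace 𝕜 A] (c : 𝕜)
    (f : WeightedCc A μ ω) (s : G) : (c • f) s = c • f s := rfl

/-- The two functions may take values in different spaces, so that a real cutoff can dominate an
`A`-valued function. -/
theorem WeightedCc.norm_le_of_forall_le (f : WeightedCc A μ ω) (g : WeightedCc B μ ω) (c : ℝ)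
    (h : ∀ s, ‖f s‖ ≤ c * ‖g s‖) : ‖f‖ ≤ c * ‖g‖ := by
  rw [WeightedCc.norm_def, WeightedCc.norm_def, ← integral_const_mul]
  refine integral_mono f.integrable_norm_mul (g.integrable_norm_mul.const_mul c) fun s => ?_
  rw [← mul_assoc]
  exact mul_le_mul_of_nonneg_right (h s) (ω s).coe_nonneg

variable (μ ω) in
/-- A cutoff function for a compact set. -/
theorem WeightedCc.exists_cutoff {K : Set G} (hK : IsCompact K) :
    ∃ χ : WeightedCc ℝ μ ω, ∀ s ∈ K, χ s = 1 := by
  obtain ⟨χ, h1, -, hs, -⟩ := exists_continuous_one_zero_of_isCompact hK isClosed_empty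
    (Set.disjoint_empty K)
  exact ⟨WeightedCc.mk μ ω χ χ.continuous hs, fun s hs => h1 hs⟩

/-- Functions supported in a fixed compact set that converge uniformly converge in norm. -/
theorem WeightedCc.tendsto_of_uniform {ι : Type*} {l : Filter ι} {F : ι → WeightedCc A μ ω}
    {f : WeightedCc A μ ω} {K : Set G} (hK : IsCompact K)
    (hF : ∀ᶠ i in l, ∀ s ∉ K, F i s = 0) (hf : ∀ s ∉ K, f s = 0)
    (h : ∀ ε > 0, ∀ᶠ i in l, ∀ s ∈ K, ‖F i s - f s‖ ≤ ε) : Tendsto F l (𝓝 f) := by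
  obtain ⟨χ, hχ⟩ := WeightedCc.exists_cutoff μ ω hK
  -- The cutoff is 1 on K, so a uniform bound δ on K gives the norm bound δ‖χ‖. The `+ 1` below
  -- keeps the denominator positive.
  rw [Metric.tendsto_nhds]
  intro ε hε
  have hpos : 0 < ‖χ‖ + 1 := by positivity
  filter_upwards [hF, h (ε / (‖χ‖ + 1)) (by positivity)] with i hi1 hi2
  rw [dist_eq_norm]
  calc ‖F i - f‖ ≤ ε / (‖χ‖ + 1) * ‖χ‖ := by
        refine WeightedCc.norm_le_of_forall_le _ _ _ fun s => ?_
        by_cases hs : s ∈ K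
        · simpa [hχ s hs] using hi2 s hs
        · simp only [WeightedCc.sub_apply, hi1 s hs, hf s hs, sub_zero, norm_zero]
          positivity
    _ < ε / (‖χ‖ + 1) * (‖χ‖ + 1) := by
        refine mul_lt_mul_of_pos_left (lt_add_one _) (by positivity)
    _ = ε := div_mul_cancel₀ _ hpos.ne'

/-- Locally uniform convergence on a compact set is uniform. -/
theorem eventually_forall_mem_norm_sub_le {ι S : Type*} [TopologicalSpace S] {l : Filter ι}
    {F : ι → S → A} {f : S → A} (hf : Continuous f) {K : Set S} (hK : IsCompact K)
    (h : ∀ s ∈ K, Tendsto (fun p : ι × S => F p.1 p.2) (l ×ˢ 𝓝 s) (𝓝 (f s)))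
    {ε : ℝ} (hε : 0 < ε) : ∀ᶠ i in l, ∀ s ∈ K, ‖F i s - f s‖ ≤ ε := by
  -- The tube lemma: compactness of K turns the local estimates into membership in the product with
  -- the neighbourhood filter of K.
  have hmem : {p : ι × S | ‖F p.1 p.2 - f p.2‖ ≤ ε} ∈ l ×ˢ 𝓝ˢ K := by
    refine hK.mem_prod_nhdsSet_of_forall fun s hs => ?_
    have h1 : Tendsto (fun p : ι × S => F p.1 p.2 - f p.2) (l ×ˢ 𝓝 s) (𝓝 (f s - f s)) :=
      (h s hs).sub ((hf.tendsto s).comp tendsto_snd)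
    rw [sub_self] at h1
    filter_upwards [h1.norm.eventually (gt_mem_nhds (norm_zero.trans_lt hε))] with p hp
    exact hp.le
  have h2 := Filter.Eventually.curry (p := fun p => ‖F p.1 p.2 - f p.2‖ ≤ ε) hmem
  filter_upwards [h2] with i hi s hs
  exact hi.self_of_nhdsSet s hs

end Cc

/-! ### Bump functions -/

section Bump

variable {G : Type*} [Group G] [TopologicalSpace G] [IsTopologicalGroup G] [LocallyCompactSpace G]
  [T2Space G] [MeasurableSpace G] [BorelSpace G]
  (μ : Measure G) [μ.IsHaarMeasure] [μ.Regular]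

/-- `φ` is a continuous compactly supported probability density that vanishes off `V`. -/
structure IsBump (V : Set G) (φ : G → ℝ) : Prop where
  continuous : Continuous φ
  hasCompactSupport : HasCompactSupport φ
  nonneg : ∀ s, 0 ≤ φ s
  eq_zero : ∀ s ∉ V, φ s = 0
  integral_eq : ∫ s, φ s ∂μ = 1

theorem exists_isBump (V : Set G) (hV : V ∈ 𝓝 (1 : G)) : ∃ φ : G → ℝ, IsBump μ V φ := by
  obtain ⟨φ, h1, h0, hs, hI⟩ := exists_continuous_one_zero_of_isCompact
    (isCompact_singleton (x := (1 : G))) (isOpen_interior (s := V)).isClosed_compl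
    (Set.disjoint_singleton_left.2 fun h => h (mem_interior_iff_mem_nhds.2 hV))
  have hpos : 0 < ∫ s, φ s ∂μ :=
    φ.continuous.integral_pos_of_hasCompactSupport_nonneg_nonzero hs (fun s => (hI s).1)
      (x := 1) (by simp [h1 (Set.mem_singleton _)])
  refine ⟨fun s => (∫ s, φ s ∂μ)⁻¹ * φ s, φ.continuous.const_mul _, hs.mul_left,
    fun s => mul_nonneg (inv_nonneg.2 hpos.le) (hI s).1, fun s hsV => ?_, ?_⟩
  · have : φ s = 0 := h0 fun h => hsV (interior_subset h)
    simp [this]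
  · rw [integral_const_mul, inv_mul_cancel₀ hpos.ne']

variable {μ}

/-- Averaging against a probability density carried by V cannot move further from `v` than the
values on V do. -/
theorem IsBump.norm_integral_sub_le {𝕜 E : Type*} [RCLike 𝕜] [NormedAddCommGroup E]
    [NormedSpace ℝ E] [NormedSpace 𝕜 E] [CompleteSpace E] {V : Set G} {φ : G → ℝ}
    (hφ : IsBump μ V φ) {F : G → E} (hF : Continuous F) {v : E} {ε : ℝ}
    (h : ∀ r ∈ V, ‖F r - v‖ ≤ ε) :
    ‖∫ r, (φ r : 𝕜) • F r ∂μ - v‖ ≤ ε := by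
  have hc : Continuous fun r => (φ r : 𝕜) := RCLike.continuous_ofReal.comp hφ.continuous
  have hcs : HasCompactSupport fun r => (φ r : 𝕜) :=
    hφ.hasCompactSupport.comp_left (g := fun x : ℝ => (x : 𝕜)) RCLike.ofReal_zero
  have hv : v = ∫ r, (φ r : 𝕜) • v ∂μ := by
    rw [integral_smul_const, integral_ofReal, hφ.integral_eq, RCLike.ofReal_one, one_smul]
  have i1 : Integrable (fun r => (φ r : 𝕜) • F r) μ :=
    (hc.smul hF).integrable_of_hasCompactSupport hcs.smul_right
  have i2 : Integrable (fun r => (φ r : 𝕜) • v) μ :=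
    (hc.smul continuous_const).integrable_of_hasCompactSupport hcs.smul_right
  calc ‖∫ r, (φ r : 𝕜) • F r ∂μ - v‖ = ‖∫ r, (φ r : 𝕜) • (F r - v) ∂μ‖ := by
        conv_lhs => rw [hv]
        rw [← integral_sub i1 i2]
        simp only [smul_sub]
    _ ≤ ∫ r, φ r * ε ∂μ := by
        refine norm_integral_le_of_norm_le ?_ (.of_forall fun r => ?_)
        · exact (hφ.continuous.integrable_of_hasCompactSupport hφ.hasCompactSupport).mul_const ε
        · rw [norm_smul, RCLike.norm_ofReal, abs_of_nonneg (hφ.nonneg r)]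
          by_cases hr : r ∈ V
          · exact mul_le_mul_of_nonneg_left (h r hr) (hφ.nonneg r)
          · simp [hφ.eq_zero r hr]
    _ = ε := by rw [integral_mul_const, hφ.integral_eq, one_mul]

variable (𝕜 : Type*) [RCLike 𝕜] {A : Type*} [NormedAddCommGroup A] [NormedSpace 𝕜 A]

/-- The elementary tensor `φ ⊗ a : r ↦ φ(r) a`. -/
def IsBump.tensor (ω : Weight G) {V : Set G} {φ : G → ℝ} (hφ : IsBump μ V φ) (a : A) :
    WeightedCc A μ ω :=
  WeightedCc.mk μ ω (fun r => (φ r : 𝕜) • a)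
    ((RCLike.continuous_ofReal.comp hφ.continuous).smul continuous_const)
    (hφ.hasCompactSupport.mono fun r hr h => hr (by simp [h]))

/-- Local boundedness of the weight near the identity makes this bound uniform over small V, so
tensors can form a bounded approximate identity. -/
theorem IsBump.norm_tensor_le (ω : Weight G) {V : Set G} {φ : G → ℝ} (hφ : IsBump μ V φ) (a : A)
    {C : ℝ} (hC : ∀ r ∈ V, (ω r : ℝ) ≤ C) : ‖hφ.tensor 𝕜 ω a‖ ≤ ‖a‖ * C := by
  rw [WeightedCc.norm_def]
  calc ∫ r, ‖hφ.tensor 𝕜 ω a r‖ * (ω r : ℝ) ∂μ ≤ ∫ r, φ r * (‖a‖ * C) ∂μ := by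
        refine integral_mono (WeightedCc.integrable_norm_mul _)
          ((hφ.continuous.integrable_of_hasCompactSupport hφ.hasCompactSupport).mul_const _)
          fun r => ?_
        simp only [IsBump.tensor, WeightedCc.mk_apply, norm_smul, RCLike.norm_ofReal,
          abs_of_nonneg (hφ.nonneg r), mul_assoc]
        by_cases hr : r ∈ V
        · have := hC r hr
          have := hφ.nonneg r
          gcongr
        · simp [hφ.eq_zero r hr]
    _ = ‖a‖ * C := by rw [integral_mul_const, hφ.integral_eq, one_mul]

end Bump

open scoped Pointwise

/-! ### Left centralizers of `C_c(G, A)` -/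

section Centralizers

variable {𝕜 G A : Type*} [RCLike 𝕜]
  [Group G] [TopologicalSpace G] [IsTopologicalGroup G] [LocallyCompactSpace G] [T2Space G]
  [MeasurableSpace G] [BorelSpace G]
  [NonUnitalNormedRing A] [NormedSpace ℝ A] [NormedSpace 𝕜 A] [IsScalarTower ℝ 𝕜 A]
  [IsScalarTower 𝕜 A A] [SMulCommClass 𝕜 A A] [CompleteSpace A]
  (μ : Measure G) [μ.IsHaarMeasure] [μ.Regular] (ω : Weight G)

variable (𝕜) in
/-- Pointwise left multiplication by an element of `A`. -/
def leftMul (a : A) : WeightedCc A μ ω →L[𝕜] WeightedCc A μ ω :=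
  LinearMap.mkContinuous
    { toFun := fun f => WeightedCc.mk μ ω (fun s => a * f s) (continuous_const.mul f.continuous)
        f.hasCompactSupport.mul_left
      map_add' := fun _ _ => WeightedCc.ext fun _ => mul_add _ _ _
      map_smul' := fun _ _ => WeightedCc.ext fun _ => mul_smul_comm _ _ _ }
    ‖a‖ fun _ => WeightedCc.norm_le_of_forall_le _ _ _ fun _ => norm_mul_le _ _

@[simp] theorem leftMul_apply (a : A) (f : WeightedCc A μ ω) (s : G) :
    leftMul 𝕜 μ ω a f s = a * f s := rfl

theorem norm_leftMul_apply_le (a : A) (f : WeightedCc A μ ω) :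
    ‖leftMul 𝕜 μ ω a f‖ ≤ ‖a‖ * ‖f‖ :=
  WeightedCc.norm_le_of_forall_le _ _ _ fun _ => norm_mul_le _ _

namespace DynamicalSystem

variable (α : DynamicalSystem 𝕜 G A) (hα : α.UniformlyBounded)

@[simp] theorem act_mul_apply (r s : G) (a : A) : α.act (r * s) a = α.act r (α.act s a) := by
  rw [_root_.map_mul]; rfl

@[simp] theorem act_one_apply (a : A) : α.act 1 a = a := by
  rw [_root_.map_one]; rfl

@[simp] theorem act_act_inv (r : G) (a : A) : α.act r (α.act r⁻¹ a) = a := by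
  rw [← act_mul_apply, mul_inv_cancel, act_one_apply]

/-- The translate `s ↦ α_r(f(r⁻¹ s))`. -/
def translateFun (r : G) (f : WeightedCc A μ ω) : WeightedCc A μ ω :=
  WeightedCc.mk μ ω (fun s => α.act r (f (r⁻¹ * s)))
    ((α.act r).continuous.comp (f.continuous.comp (continuous_const.mul continuous_id)))
    ((f.hasCompactSupport.comp_homeomorph (Homeomorph.mulLeft r⁻¹)).comp_left
      (g := α.act r) (map_zero _))

theorem translateFun_apply (r : G) (f : WeightedCc A μ ω) (s : G) :
    α.translateFun μ ω r f s = α.act r (f (r⁻¹ * s)) := rfl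

/-- Left invariance moves the translation onto the weight, where ω(rs) ≤ ω(r)ω(s). This is the
source of the bound ‖U_r‖ ≤ C ω(r). -/
theorem norm_translateFun_le (r : G) (f : WeightedCc A μ ω) :
    ‖α.translateFun μ ω r f‖ ≤ ‖α.act r‖ * ω r * ‖f‖ := by
  rw [WeightedCc.norm_def, WeightedCc.norm_def, ← integral_const_mul,
    ← integral_mul_left_eq_self _ r]
  refine integral_mono_of_nonneg (.of_forall fun s => mul_nonneg (norm_nonneg _) (ω _).coe_nonneg)
    (f.integrable_norm_mul.const_mul _) (.of_forall fun s => ?_)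
  have h1 : (ω (r * s) : ℝ) ≤ ω r * ω s := by exact_mod_cast ω.toFun_mul_le r s
  have h2 : ‖α.translateFun μ ω r f (r * s)‖ ≤ ‖α.act r‖ * ‖f s‖ := by
    simpa [translateFun_apply] using (α.act r).le_opNorm (f s)
  calc ‖α.translateFun μ ω r f (r * s)‖ * (ω (r * s) : ℝ)
      ≤ (‖α.act r‖ * ‖f s‖) * (ω r * ω s) := by gcongr
    _ = ‖α.act r‖ * ω r * (‖f s‖ * ω s) := by ring

/-- The translation `f ↦ (s ↦ α_r(f(r⁻¹ s)))` as a bounded operator. -/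
def translate (r : G) : WeightedCc A μ ω →L[𝕜] WeightedCc A μ ω :=
  LinearMap.mkContinuous
    { toFun := α.translateFun μ ω r
      map_add' := fun f g => WeightedCc.ext fun s => by simp [translateFun_apply]
      map_smul' := fun c f => WeightedCc.ext fun s => by simp [translateFun_apply] }
    (‖α.act r‖ * ω r) (α.norm_translateFun_le μ ω r)

@[simp] theorem translate_apply (r : G) (f : WeightedCc A μ ω) (s : G) :
    α.translate μ ω r f s = α.act r (f (r⁻¹ * s)) := rfl

theorem norm_translate_apply_le (r : G) (f : WeightedCc A μ ω) :
    ‖α.translate μ ω r f‖ ≤ ‖α.act r‖ * ω r * ‖f‖ :=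
  α.norm_translateFun_le μ ω r f

theorem leftMul_conv (a : A) (f g : WeightedCc A μ ω) :
    leftMul 𝕜 μ ω a (α.conv μ ω hα f g) = α.conv μ ω hα (leftMul 𝕜 μ ω a f) g := by
  refine WeightedCc.ext fun s => ?_
  rw [leftMul_apply, conv_apply, conv_apply]
  have := (ContinuousLinearMap.mul 𝕜 A a).integral_comp_comm
    (α.integrable_twist μ hα f.continuous f.hasCompactSupport g.continuous s)
  simpa [mul_assoc] using this.symm

/-- Multiplicativity of α_t and the substitution r ↦ t r. Together with `leftMul_conv` it says that
`A` and `G` act by left centralizers. -/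
theorem translate_conv (t : G) (f g : WeightedCc A μ ω) :
    α.translate μ ω t (α.conv μ ω hα f g) = α.conv μ ω hα (α.translate μ ω t f) g := by
  refine WeightedCc.ext fun s => ?_
  rw [translate_apply, conv_apply, conv_apply, ← (α.act t).integral_comp_comm
      (α.integrable_twist μ hα f.continuous f.hasCompactSupport g.continuous (t⁻¹ * s)),
    ← integral_mul_left_eq_self (fun r => α.translate μ ω t f r * α.act r (g (r⁻¹ * s))) t]
  refine integral_congr_ae (.of_forall fun r => ?_)
  simp [α.act_mul, mul_assoc]

theorem translate_one (f : WeightedCc A μ ω) : α.translate μ ω 1 f = f :=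
  WeightedCc.ext fun s => by simp

theorem translate_mul (r t : G) (f : WeightedCc A μ ω) :
    α.translate μ ω (r * t) f = α.translate μ ω r (α.translate μ ω t f) :=
  WeightedCc.ext fun s => by simp [mul_assoc]

/-- The covariance relation at the level of functions, inherited by every pair built from these
actions. -/
theorem translate_leftMul (r : G) (a : A) (f : WeightedCc A μ ω) :
    α.translate μ ω r (leftMul 𝕜 μ ω a f) =
      leftMul 𝕜 μ ω (α.act r a) (α.translate μ ω r f) :=
  WeightedCc.ext fun s => by simp [α.act_mul]

/-- For r in a compact neighbourhood N of r₀ all translates live on the fixed compact set N · supp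
f, so joint continuity suffices. -/
theorem continuous_translate_apply (hα : α.UniformlyBounded) (f : WeightedCc A μ ω) :
    Continuous fun r => α.translate μ ω r f := by
  rw [continuous_iff_continuousAt]
  intro r₀
  obtain ⟨N, hN, hNr⟩ := exists_compact_mem_nhds r₀
  have hK := hN.mul f.hasCompactSupport.isCompact
  have hzero : ∀ r ∈ N, ∀ s ∉ N * tsupport f, α.translate μ ω r f s = 0 := fun r hr s hs => by
    have : r⁻¹ * s ∉ tsupport f := fun h => hs (Set.mem_mul.2 ⟨r, hr, _, h, by group⟩)
    rw [translate_apply, image_eq_zero_of_notMem_tsupport this, map_zero]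
  refine WeightedCc.tendsto_of_uniform hK ?_ (hzero r₀ (mem_of_mem_nhds hNr)) fun ε hε => ?_
  · filter_upwards [hNr] with r hr using hzero r hr
  · refine eventually_forall_mem_norm_sub_le (F := fun r s => α.translate μ ω r f s)
      (WeightedCc.continuous _) hK (fun s _ => ?_) hε
    have hc : Continuous fun p : G × G => α.act p.1 (f (p.1⁻¹ * p.2)) :=
      (α.continuous_uncurry hα).comp (continuous_fst.prodMk
        (f.continuous.comp (continuous_fst.inv.mul continuous_snd)))
    rw [← nhds_prod_eq]
    exact hc.tendsto (r₀, s)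

end DynamicalSystem

/-! ### Approximate identities -/

/-- Write u v = u(v - a) + u a. Boundedness lets an approximate identity act on a moving element,
which gives uniformity over compact sets. -/
theorem tendsto_mul_of_tendsto {ι : Type*} {q : Filter ι} {u v : ι → A} {a : A} {M : ℝ}
    (hM : ∀ᶠ i in q, ‖u i‖ ≤ M) (hu : Tendsto (fun i => u i * a) q (𝓝 a))
    (hv : Tendsto v q (𝓝 a)) : Tendsto (fun i => u i * v i) q (𝓝 a) := by
  have h1 : Tendsto (fun i => u i * (v i - a)) q (𝓝 0) := by
    have h0 : Tendsto (fun i => M * ‖v i - a‖) q (𝓝 0) := by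
      simpa using (tendsto_iff_norm_sub_tendsto_zero.1 hv).const_mul M
    refine squeeze_zero_norm' ?_ h0
    filter_upwards [hM] with i hi
    exact (norm_mul_le _ _).trans (mul_le_mul_of_nonneg_right hi (norm_nonneg _))
  simpa [mul_sub] using h1.add hu

theorem tendsto_leftMul {l : Filter A} (hl : l.IsApproximateUnit) {M : ℝ}
    (hM : ∀ᶠ u in l, ‖u‖ ≤ M) (f : WeightedCc A μ ω) :
    Tendsto (fun u => leftMul 𝕜 μ ω u f) l (𝓝 f) := by
  have hK := f.hasCompactSupport.isCompact
  have hzero : ∀ s ∉ tsupport f, f s = 0 := fun s hs => image_eq_zero_of_notMem_tsupport hs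
  refine WeightedCc.tendsto_of_uniform hK (.of_forall fun u s hs => ?_) hzero fun ε hε => ?_
  · rw [leftMul_apply, hzero s hs, mul_zero]
  · refine eventually_forall_mem_norm_sub_le (F := fun u s => leftMul 𝕜 μ ω u f s)
      f.continuous hK (fun s _ => ?_) hε
    exact tendsto_mul_of_tendsto (tendsto_fst.eventually hM)
      ((hl.tendsto_mul_right (f s)).comp tendsto_fst) ((f.continuous.tendsto s).comp tendsto_snd)

/-- `C_c(G, A)` has a bounded left approximate identity. -/
theorem DynamicalSystem.exists_leftApproxIdentity (α : DynamicalSystem 𝕜 G A)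
    (hα : α.UniformlyBounded) (hA : HasBoundedApproxIdentity A) :
    ∃ p : Filter (WeightedCc A μ ω), p.NeBot ∧ (∃ M : ℝ, ∀ᶠ e in p, ‖e‖ ≤ M) ∧
      ∀ f, Tendsto (fun e => α.conv μ ω hα e f) p (𝓝 f) := by
  obtain ⟨l, hl, M, hM⟩ := hA
  have := hl.neBot
  choose φ hφ using exists_isBump μ
  -- The approximate identity is φ_V ⊗ u, with V shrinking to 1 and, independently, u running along
  -- the approximate identity of `A`.
  let q : Filter ({V : Set G // V ∈ 𝓝 (1 : G)} × A) :=
    (comap Subtype.val (𝓝 (1 : G)).smallSets) ×ˢ l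
  have hsmall : ∀ W ∈ 𝓝 (1 : G),
      ∀ᶠ V : {V : Set G // V ∈ 𝓝 (1 : G)} in comap Subtype.val (𝓝 (1 : G)).smallSets,
        (V : Set G) ⊆ W := fun W hW =>
    tendsto_comap.eventually (eventually_smallSets_subset.2 hW)
  have hne : (comap (Subtype.val : {V : Set G // V ∈ 𝓝 (1 : G)} → Set G)
      (𝓝 (1 : G)).smallSets).NeBot :=
    comap_neBot_iff_frequently.2
      ((frequently_smallSets_mem _).mono fun s hs => ⟨⟨s, hs⟩, rfl⟩)
  let e : {V : Set G // V ∈ 𝓝 (1 : G)} × A → WeightedCc A μ ω := fun x =>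
    (hφ x.1.1 x.1.2).tensor 𝕜 ω x.2
  refine ⟨map e q, inferInstance, ?_, fun f => ?_⟩
  · obtain ⟨C, hC⟩ := ω.exists_nhds_le μ 1
    refine ⟨M * C, ?_⟩
    rw [eventually_map]
    filter_upwards [(hsmall _ hC).prod_mk hM] with x hx
    refine ((hφ x.1.1 x.1.2).norm_tensor_le 𝕜 ω x.2 (C := C)
      fun r hr => by exact_mod_cast hx.1 hr).trans ?_
    exact mul_le_mul_of_nonneg_right hx.2 C.coe_nonneg
  · rw [tendsto_map'_iff]
    obtain ⟨N, hN, hN1⟩ := exists_compact_mem_nhds (1 : G)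
    have hK := hN.mul f.hasCompactSupport.isCompact
    have hfz : ∀ r ∈ N, ∀ s ∉ N * tsupport f, f (r⁻¹ * s) = 0 := fun r hr s hs =>
      image_eq_zero_of_notMem_tsupport fun h => hs (Set.mem_mul.2 ⟨r, hr, _, h, by group⟩)
    have hconv : ∀ x s, α.conv μ ω hα (e x) f s =
        ∫ r, (φ x.1.1 x.1.2 r : 𝕜) • (x.2 * α.act r (f (r⁻¹ * s))) ∂μ := fun x s => by
      rw [DynamicalSystem.conv_apply]
      simp only [e, IsBump.tensor, WeightedCc.mk_apply, smul_mul_assoc]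
    refine WeightedCc.tendsto_of_uniform hK ?_ (fun s hs => ?_) fun ε hε => ?_
    -- As soon as V ⊆ N, the convolution is supported in N · supp f.
    · filter_upwards [(hsmall _ hN1).prod_mk (Eventually.of_forall fun _ => trivial)] with x hx s hs
      simp only [Function.comp_apply, hconv]
      refine integral_eq_zero_of_ae (.of_forall fun r => ?_)
      by_cases hr : r ∈ x.1.1
      · simp [hfz r (hx.1 hr) s hs]
      · simp [(hφ x.1.1 x.1.2).eq_zero r hr]
    · simpa using hfz 1 (mem_of_mem_nhds hN1) s hs
    · have hc : Continuous fun p : G × G => α.act p.1 (f (p.1⁻¹ * p.2)) :=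
        (α.continuous_uncurry hα).comp (continuous_fst.prodMk
          (f.continuous.comp (continuous_fst.inv.mul continuous_snd)))
      -- Before averaging: u α_r(f(r⁻¹ s)) is near f(s), uniformly in s ∈ K, for u far along `l` and
      -- r near 1. Averaging over r against φ_V then preserves the estimate.
      have key := eventually_forall_mem_norm_sub_le (l := l ×ˢ 𝓝 (1 : G))
        (F := fun (p : A × G) s => p.1 * α.act p.2 (f (p.2⁻¹ * s))) f.continuous hK
        (fun s _ => by
          refine tendsto_mul_of_tendsto ((tendsto_fst.comp tendsto_fst).eventually hM)
            ((hl.tendsto_mul_right (f s)).comp (tendsto_fst.comp tendsto_fst)) ?_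
          have h1 : Tendsto (fun p : (A × G) × G => (p.1.2, p.2)) ((l ×ˢ 𝓝 (1 : G)) ×ˢ 𝓝 s)
              (𝓝 (1, s)) :=
            (tendsto_snd.comp tendsto_fst).prodMk_nhds tendsto_snd
          simpa [Function.comp_def] using (hc.tendsto (1, s)).comp h1) hε
      obtain ⟨pU, hU, pV, hV, hUV⟩ := eventually_prod_iff.1 key
      filter_upwards [(hsmall _ hV).prod_mk hU] with x hx s hs
      simp only [Function.comp_apply, hconv]
      refine (hφ x.1.1 x.1.2).norm_integral_sub_le (𝕜 := 𝕜) ?_ fun r hr => ?_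
      · exact continuous_const.mul (hc.comp (continuous_id.prodMk continuous_const))
      · exact hUV hx.2 (hx.1 hr) s hs

end Centralizers

/-! ### Extending centralizers along a non-degenerate representation -/

section Extension

variable {𝕜 E X : Type*} [RCLike 𝕜] [NormedAddCommGroup E] [NormedSpace 𝕜 E]
  [NormedAddCommGroup X] [NormedSpace 𝕜 X]

theorem IsNondegenerate.ext {T : E →L[𝕜] X →L[𝕜] X} (hT : IsNondegenerate T) {S₁ S₂ : X →L[𝕜] X}
    (h : ∀ e x, S₁ (T e x) = S₂ (T e x)) : S₁ = S₂ := by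
  refine ContinuousLinearMap.ext_on hT ?_
  rintro _ ⟨e, x, rfl⟩
  exact h e x

/-- A bounded net of operators that converges strongly on `T(E)X` converges strongly. -/
theorem IsNondegenerate.tendsto {T : E →L[𝕜] X →L[𝕜] X} (hT : IsNondegenerate T) {ι : Type*}
    {q : Filter ι} {S : ι → X →L[𝕜] X} {S₀ : X →L[𝕜] X} {M : ℝ} (hM : ∀ᶠ i in q, ‖S i‖ ≤ M)
    (h : ∀ e x, Tendsto (fun i => S i (T e x)) q (𝓝 (S₀ (T e x)))) (x : X) :
    Tendsto (fun i => S i x) q (𝓝 (S₀ x)) := by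
  have hspan : ∀ y ∈ Submodule.span 𝕜 {y : X | ∃ (e : E) (x : X), T e x = y},
      Tendsto (fun i => S i y) q (𝓝 (S₀ y)) := fun y hy => by
    induction hy using Submodule.span_induction with
    | mem y hy => obtain ⟨e, x, rfl⟩ := hy; exact h e x
    | zero => simpa using tendsto_const_nhds
    | add y z _ _ hy hz => simpa using hy.add hz
    | smul c y _ hy => simpa using hy.const_smul c
  rw [Metric.tendsto_nhds]
  intro ε hε
  -- B absorbs both operator bounds of the three-term estimate; `|M|` because M has no assumed sign,
  -- and `+ 1` for positivity.
  set B : ℝ := |M| + ‖S₀‖ + 1 with hB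
  have hBpos : 0 < B := by positivity
  obtain ⟨y, hy, hxy⟩ := Metric.mem_closure_iff.1 (hT x) (ε / 2 / B) (by positivity)
  filter_upwards [hM, Metric.tendsto_nhds.1 (hspan y hy) (ε / 2) (by positivity)] with i hi1 hi2
  rw [dist_eq_norm] at hxy hi2 ⊢
  have e1 : S i x - S₀ x = S i (x - y) + (S i y - S₀ y) - S₀ (x - y) := by
    simp only [map_sub]; abel
  have h1 : ‖S i (x - y)‖ ≤ |M| * ‖x - y‖ :=
    (S i).le_of_opNorm_le (hi1.trans (le_abs_self M)) _
  have h2 : ‖S₀ (x - y)‖ ≤ ‖S₀‖ * ‖x - y‖ := S₀.le_opNorm _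
  have h3 : B * ‖x - y‖ < ε / 2 := by
    rwa [lt_div_iff₀ hBpos, mul_comm] at hxy
  have h4 := norm_nonneg (x - y)
  calc ‖S i x - S₀ x‖ ≤ ‖S i (x - y)‖ + ‖S i y - S₀ y‖ + ‖S₀ (x - y)‖ := by
        rw [e1]
        exact (norm_sub_le _ _).trans (add_le_add_left (norm_add_le _ _) _)
    _ < ε := by nlinarith

/-- For y = ∑ T(f_i)x_i, the centralizer identity gives T(m e)y = ∑ T(m(e f_i))x_i → ∑ T(m f_i)x_i.
The bound ‖T‖cM on T(m e) survives in the limit, which settles well-definedness and boundedness of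
T(f)x ↦ T(m f)x together. -/
theorem IsNondegenerate.exists_extension [CompleteSpace X] {T : E →L[𝕜] X →L[𝕜] X}
    (hT : IsNondegenerate T) {mul : E → E → E} (hmul : ∀ e f, T (mul e f) = T e * T f)
    {p : Filter E} [p.NeBot] {M : ℝ} (hM : ∀ᶠ e in p, ‖e‖ ≤ M)
    (hp : ∀ f, Tendsto (fun e => mul e f) p (𝓝 f))
    (m : E →L[𝕜] E) {c : ℝ} (hc0 : 0 ≤ c) (hc : ∀ f, ‖m f‖ ≤ c * ‖f‖)
    (hm : ∀ e f, m (mul e f) = mul (m e) f) :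
    ∃ S : X →L[𝕜] X, (∀ f x, S (T f x) = T (m f) x) ∧ ‖S‖ ≤ ‖T‖ * (c * M) := by
  have hM0 : 0 ≤ M := by
    obtain ⟨e, he⟩ := hM.exists
    exact (norm_nonneg e).trans he
  -- Formal sums of pairs (f, x): `ev` evaluates them in the span of T(E)X, while `ev'` is what the
  -- desired operator must do to them.
  let ev : (E × X →₀ 𝕜) →ₗ[𝕜] X := Finsupp.linearCombination 𝕜 fun z : E × X => T z.1 z.2
  let ev' : (E × X →₀ 𝕜) →ₗ[𝕜] X := Finsupp.linearCombination 𝕜 fun z : E × X => T (m z.1) z.2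
  have hdense : DenseRange ev := by
    have : (Set.range ev) = (Submodule.span 𝕜 {y : X | ∃ (e : E) (x : X), T e x = y} : Set X) := by
      rw [← LinearMap.coe_range, Finsupp.range_linearCombination]
      congr 2
      ext y
      simp
    rw [DenseRange, this]
    exact hT
  have hbound : ∀ t, ‖ev' t‖ ≤ ‖T‖ * (c * M) * ‖ev t‖ := fun t => by
    have hlim : Tendsto (fun e => T (m e) (ev t)) p (𝓝 (ev' t)) := by
      have h1 : ∀ e, T (m e) (ev t) = ∑ z ∈ t.support, t z • T (m (mul e z.1)) z.2 := fun e => by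
        simp only [ev, Finsupp.linearCombination_apply, Finsupp.sum, map_sum, map_smul, hm, hmul]
        rfl
      simp only [h1, ev', Finsupp.linearCombination_apply, Finsupp.sum]
      refine tendsto_finsetSum _ fun z _ => Tendsto.const_smul ?_ _
      have hcont : Continuous fun f => T (m f) z.2 :=
        (T.continuous.comp m.continuous).clm_apply continuous_const
      exact (hcont.tendsto z.1).comp (hp z.1)
    refine le_of_tendsto hlim.norm ?_
    filter_upwards [hM] with e he
    refine (T (m e)).le_of_opNorm_le (T.le_of_opNorm_le_of_le le_rfl ?_) _
    exact (hc e).trans (mul_le_mul_of_nonneg_left he hc0)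
  refine ⟨ev'.extendOfNorm ev, fun f x => ?_,
    LinearMap.opNorm_extendOfNorm_le hdense (by positivity) hbound⟩
  have := LinearMap.extendOfNorm_eq hdense ⟨_, hbound⟩ (Finsupp.single (f, x) 1)
  simpa [ev, ev'] using this

end Extension

/-! ### Covariant pairs from non-degenerate representations -/

section Disintegration

variable {𝕜 G A X : Type*} [RCLike 𝕜]
  [Group G] [TopologicalSpace G] [IsTopologicalGroup G] [LocallyCompactSpace G] [T2Space G]
  [MeasurableSpace G] [BorelSpace G]
  [NonUnitalNormedRing A] [NormedSpace ℝ A] [NormedSpace 𝕜 A] [IsScalarTower ℝ 𝕜 A]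
  [IsScalarTower 𝕜 A A] [SMulCommClass 𝕜 A A] [CompleteSpace A]
  [NormedAddCommGroup X] [NormedSpace 𝕜 X]
  {μ : Measure G} [μ.IsHaarMeasure] [μ.Regular] {ω : Weight G}

/-- A non-degenerate representation of `C_c(G, A)` extends to the centralizers given by `A` and
`G`. -/
theorem DynamicalSystem.exists_covariantRep [CompleteSpace X] (α : DynamicalSystem 𝕜 G A)
    (hα : α.UniformlyBounded) (hA : HasBoundedApproxIdentity A)
    {T : WeightedCc A μ ω →L[𝕜] X →L[𝕜] X}
    (hmul : ∀ f g, T (α.conv μ ω hα f g) = T f * T g) (hT : IsNondegenerate T) :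
    ∃ (π : A →L[𝕜] X →L[𝕜] X) (U : G → X →L[𝕜] X), IsCovariantRep α π U ∧ WeightBounded U ω ∧
      (∀ a f x, π a (T f x) = T (leftMul 𝕜 μ ω a f) x) ∧
      ∀ r f x, U r (T f x) = T (α.translate μ ω r f) x := by
  obtain ⟨p, hp, ⟨M, hM⟩, hlim⟩ := α.exists_leftApproxIdentity μ ω hα hA
  obtain ⟨C, hC⟩ := id hα
  have hC0 : 0 ≤ C := (norm_nonneg _).trans (hC 1)
  choose π hπ hπn using fun a : A => hT.exists_extension hmul hM hlim (leftMul 𝕜 μ ω a)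
    (norm_nonneg a) (norm_leftMul_apply_le μ ω a) (α.leftMul_conv μ ω hα a)
  choose U hU hUn using fun r : G => hT.exists_extension hmul hM hlim (α.translate μ ω r)
    (mul_nonneg hC0 (ω r).coe_nonneg) (fun f => (α.norm_translate_apply_le μ ω r f).trans
      (mul_le_mul_of_nonneg_right (mul_le_mul_of_nonneg_right (hC r) (ω r).coe_nonneg)
        (norm_nonneg f))) (α.translate_conv μ ω hα r)
  let πL : A →L[𝕜] X →L[𝕜] X := LinearMap.mkContinuous
    { toFun := π
      map_add' := fun a b => hT.ext fun f x => by
        have : leftMul 𝕜 μ ω (a + b) f = leftMul 𝕜 μ ω a f + leftMul 𝕜 μ ω b f :=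
          WeightedCc.ext fun s => by simp [add_mul]
        simp [hπ, this]
      map_smul' := fun c a => hT.ext fun f x => by
        have : leftMul 𝕜 μ ω (c • a) f = c • leftMul 𝕜 μ ω a f :=
          WeightedCc.ext fun s => by simp [smul_mul_assoc]
        simp [hπ, this] }
    (‖T‖ * M) fun a => (hπn a).trans (le_of_eq (by ring))
  have hπL : ∀ a f x, πL a (T f x) = T (leftMul 𝕜 μ ω a f) x := hπ
  refine ⟨πL, U, ⟨fun a b => hT.ext fun f x => ?_, ?_, hT.ext fun f x => ?_,
    fun r s => hT.ext fun f x => ?_, fun x => ?_, fun a r => hT.ext fun f x => ?_⟩,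
    ⟨‖T‖ * C * M, fun r => (hUn r).trans (le_of_eq (by ring))⟩, hπL, hU⟩
  · have : leftMul 𝕜 μ ω (a * b) f = leftMul 𝕜 μ ω a (leftMul 𝕜 μ ω b f) :=
      WeightedCc.ext fun s => by simp [mul_assoc]
    simp [hπL, this]
  · obtain ⟨l, hl, N, hN⟩ := hA
    have := hl.neBot
    -- As u runs along the approximate identity of `A`, π(u)T(f)x = T(u f)x tends to T(f)x, so the
    -- closed span of π(A)X contains T(E)X, with E = C_c(G, A).
    refine dense_iff_closure_eq.2 (Set.eq_univ_of_univ_subset ?_)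
    rw [← hT.closure_eq]
    refine closure_minimal ?_ isClosed_closure
    change Submodule.span 𝕜 _ ≤ (Submodule.span 𝕜 _).topologicalClosure
    refine Submodule.span_le.2 ?_
    rintro _ ⟨f, x, rfl⟩
    have h1 : Tendsto (fun u => πL u (T f x)) l (𝓝 (T f x)) := by
      simp only [hπL]
      have hcont : Continuous fun f => T f x := T.continuous.clm_apply continuous_const
      exact (hcont.tendsto f).comp (tendsto_leftMul μ ω hl hN f)
    exact mem_closure_of_tendsto h1 (.of_forall fun u => Submodule.subset_span ⟨u, _, rfl⟩)
  · simp [hU, α.translate_one μ ω]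
  · simp [hU, α.translate_mul μ ω]
  · rw [continuous_iff_continuousAt]
    intro r₀
    obtain ⟨W, hW⟩ := ω.exists_nhds_le μ r₀
    have hM0 : 0 ≤ M := by
      obtain ⟨e, he⟩ := hM.exists
      exact (norm_nonneg e).trans he
    -- Local boundedness of the weight bounds U near r₀; strong continuity then only has to be
    -- checked on T(f)x.
    have hev : ∀ᶠ r in 𝓝 r₀, ‖U r‖ ≤ ‖T‖ * (C * W * M) := by
      filter_upwards [hW] with r hr
      have : (ω r : ℝ) ≤ W := by exact_mod_cast hr
      exact (hUn r).trans (by gcongr)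
    refine hT.tendsto hev (fun f x => ?_) x
    simp only [hU]
    have hcont : Continuous fun f => T f x := T.continuous.clm_apply continuous_const
    exact (hcont.comp (α.continuous_translate_apply μ ω hα f)).tendsto r₀
  · simp [hU, hπL, α.translate_leftMul μ ω, ← α.translate_mul μ ω, α.translate_one μ ω]

end Disintegration

open scoped Pointwise BoundedContinuousFunction

/-! ### Twisted convolution as a vector-valued integral -/

section ConvIntegral

variable {𝕜 G A F : Type*} [RCLike 𝕜]
  [Group G] [TopologicalSpace G] [IsTopologicalGroup G] [LocallyCompactSpace G] [T2Space G]
  [MeasurableSpace G] [BorelSpace G]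
  [NonUnitalNormedRing A] [NormedSpace ℝ A] [NormedSpace 𝕜 A] [IsScalarTower ℝ 𝕜 A]
  [IsScalarTower 𝕜 A A] [SMulCommClass 𝕜 A A] [CompleteSpace A]
  [NormedAddCommGroup F] [NormedSpace ℝ F] [NormedSpace 𝕜 F] [CompleteSpace F]
  {μ : Measure G} [μ.IsHaarMeasure] [μ.Regular] {ω : Weight G}

/-- An element of `C_c(G, A)` as a bounded continuous function. -/
def WeightedCc.toBounded (f : WeightedCc A μ ω) : G →ᵇ A :=
  BoundedContinuousFunction.ofNormedAddCommGroup f f.continuous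
    (f.hasCompactSupport.exists_bound_of_continuous f.continuous).choose
    (f.hasCompactSupport.exists_bound_of_continuous f.continuous).choose_spec

variable (𝕜 A) in
/-- Multiplication of bounded continuous functions by a cutoff function. -/
def WeightedCc.cutoff (χ : WeightedCc ℝ μ ω) : (G →ᵇ A) →L[𝕜] WeightedCc A μ ω :=
  LinearMap.mkContinuous
    { toFun := fun h => WeightedCc.mk μ ω (fun s => (χ s : 𝕜) • h s)
        ((RCLike.continuous_ofReal.comp χ.continuous).smul h.continuous)
        (χ.hasCompactSupport.mono fun r hr h => hr (by simp [h]))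
      map_add' := fun _ _ => WeightedCc.ext fun _ => smul_add _ _ _
      map_smul' := fun _ _ => WeightedCc.ext fun _ => smul_comm _ _ _ }
    ‖χ‖ fun h => by
      rw [mul_comm]
      refine WeightedCc.norm_le_of_forall_le _ _ _ fun s => ?_
      change ‖(χ s : 𝕜) • h s‖ ≤ _
      rw [norm_smul, RCLike.norm_ofReal, mul_comm, Real.norm_eq_abs]
      exact mul_le_mul_of_nonneg_right (h.norm_coe_le_norm s) (abs_nonneg _)

@[simp] theorem WeightedCc.cutoff_apply (χ : WeightedCc ℝ μ ω) (h : G →ᵇ A) (s : G) :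
    WeightedCc.cutoff 𝕜 A χ h s = (χ s : 𝕜) • h s := rfl

/-- `f * g = ∫ f(r) · (translate of g by r) dμ(r)`, tested against a bounded operator. -/
theorem DynamicalSystem.map_conv_eq_integral (α : DynamicalSystem 𝕜 G A) (hα : α.UniformlyBounded)
    (T : WeightedCc A μ ω →L[𝕜] F) (f g : WeightedCc A μ ω) :
    T (α.conv μ ω hα f g) = ∫ r, T (leftMul 𝕜 μ ω (f r) (α.translate μ ω r g)) ∂μ := by
  have hK := f.hasCompactSupport.isCompact.mul g.hasCompactSupport.isCompact
  obtain ⟨χ, hχ⟩ := WeightedCc.exists_cutoff μ ω hK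
  have hzero : ∀ s ∉ tsupport f * tsupport g, ∀ r, f r * α.act r (g (r⁻¹ * s)) = 0 :=
    fun s hs r => α.twist_eq_zero fun h => hs (Set.mem_mul.2 ⟨r, h.1, _, h.2, by group⟩)
  -- `WeightedCc` is not complete in general, so the integral is taken in the Banach space of
  -- bounded continuous functions. All values vanish off supp f · supp g, and the cutoff brings them
  -- back.
  let Φ : G → (G →ᵇ A) := fun r => (leftMul 𝕜 μ ω (f r) (α.translate μ ω r g)).toBounded
  have hΦ : ∀ r s, Φ r s = f r * α.act r (g (r⁻¹ * s)) := fun r s => rfl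
  have hΦc : Continuous Φ := by
    rw [continuous_iff_continuousAt]
    intro r₀
    rw [ContinuousAt, Metric.tendsto_nhds]
    intro ε hε
    have hc := α.continuous_twist hα f.continuous g.continuous
    have key := eventually_forall_mem_norm_sub_le (l := 𝓝 r₀)
      (F := fun r s => f r * α.act r (g (r⁻¹ * s))) (f := fun s => Φ r₀ s) (Φ r₀).continuous hK
      (fun s _ => by
        rw [← nhds_prod_eq]
        exact (hc.comp continuous_swap).tendsto (r₀, s)) (half_pos hε)
    filter_upwards [key] with r hr
    refine lt_of_le_of_lt ?_ (half_lt_self hε)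
    rw [BoundedContinuousFunction.dist_le (half_pos hε).le]
    intro s
    rw [dist_eq_norm]
    by_cases hs : s ∈ tsupport f * tsupport g
    · exact hr s hs
    · rw [hΦ, hΦ, hzero s hs, hzero s hs, sub_zero, norm_zero]
      exact (half_pos hε).le
  have hΦs : HasCompactSupport Φ := f.hasCompactSupport.mono fun r hr h => hr (by
    ext s
    rw [hΦ, h, zero_mul]
    rfl)
  have hΦi : Integrable Φ μ := hΦc.integrable_of_hasCompactSupport hΦs
  have h1 : α.conv μ ω hα f g = WeightedCc.cutoff 𝕜 A χ (∫ r, Φ r ∂μ) := by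
    refine WeightedCc.ext fun s => ?_
    have h2 := (BoundedContinuousFunction.evalCLM 𝕜 s).integral_comp_comm hΦi
    simp only [BoundedContinuousFunction.evalCLM_apply] at h2
    rw [WeightedCc.cutoff_apply, ← h2, DynamicalSystem.conv_apply]
    simp only [hΦ]
    by_cases hs : s ∈ tsupport f * tsupport g
    · rw [hχ s hs, RCLike.ofReal_one, one_smul]
    · simp [hzero s hs]
  have h2 : ∀ r, leftMul 𝕜 μ ω (f r) (α.translate μ ω r g) = WeightedCc.cutoff 𝕜 A χ (Φ r) :=
    fun r => WeightedCc.ext fun s => by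
      rw [WeightedCc.cutoff_apply, hΦ, leftMul_apply, translate_apply]
      by_cases hs : s ∈ tsupport f * tsupport g
      · rw [hχ s hs, RCLike.ofReal_one, one_smul]
      · rw [hzero s hs, smul_zero]
  simp only [h1, h2]
  exact ((T.comp (WeightedCc.cutoff 𝕜 A χ)).integral_comp_comm hΦi).symm

end ConvIntegral

/-! ### Integrated forms -/

section IntegratedForm

variable {𝕜 G A X : Type*} [RCLike 𝕜]
  [Group G] [TopologicalSpace G] [IsTopologicalGroup G] [LocallyCompactSpace G] [T2Space G]
  [MeasurableSpace G] [BorelSpace G]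
  [NonUnitalNormedRing A] [NormedSpace ℝ A] [NormedSpace 𝕜 A] [IsScalarTower ℝ 𝕜 A]
  [IsScalarTower 𝕜 A A] [SMulCommClass 𝕜 A A] [CompleteSpace A]
  [NormedAddCommGroup X] [NormedSpace ℝ X] [NormedSpace 𝕜 X] [IsScalarTower ℝ 𝕜 X]
  {μ : Measure G} [μ.IsHaarMeasure] [μ.Regular] {ω : Weight G}

/-- `T(f) = ∫ π(f(r)) U_r dμ(r)` for `f ∈ C_c(G, A)`, where `T` is defined on `C_c(G, A)` only. -/
def IsIntegratedOnCc (π : A →L[𝕜] X →L[𝕜] X) (U : G → X →L[𝕜] X)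
    (T : WeightedCc A μ ω →L[𝕜] X →L[𝕜] X) : Prop :=
  ∀ (f : WeightedCc A μ ω) (x : X), T f x = ∫ r, π (f r) (U r x) ∂μ

theorem integrable_integratedForm (π : A →L[𝕜] X →L[𝕜] X) {U : G → X →L[𝕜] X}
    (hU : ∀ x, Continuous fun r => U r x) (f : WeightedCc A μ ω) (x : X) :
    Integrable (fun r => π (f r) (U r x)) μ := by
  refine Continuous.integrable_of_hasCompactSupport
    ((π.continuous.comp f.continuous).clm_apply (hU x)) ?_
  exact f.hasCompactSupport.mono fun r hr h => hr (by simp [h])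

theorem exists_isIntegratedOnCc [CompleteSpace X] (π : A →L[𝕜] X →L[𝕜] X) {U : G → X →L[𝕜] X}
    (hU : ∀ x, Continuous fun r => U r x) (hω : WeightBounded U ω) :
    ∃ T : WeightedCc A μ ω →L[𝕜] X →L[𝕜] X, IsIntegratedOnCc π U T := by
  obtain ⟨C, hC⟩ := hω
  have hint := fun (f : WeightedCc A μ ω) x => integrable_integratedForm π hU f x
  let B : WeightedCc A μ ω →ₗ[𝕜] X →ₗ[𝕜] X := LinearMap.mk₂ 𝕜
    (fun f x => ∫ r, π (f r) (U r x) ∂μ)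
    (fun f g x => by
      rw [← integral_add (hint f x) (hint g x)]; simp)
    (fun c f x => by
      rw [← integral_smul]; simp)
    (fun f x y => by
      rw [← integral_add (hint f x) (hint f y)]; simp)
    (fun c f x => by
      rw [← integral_smul]; simp)
  refine ⟨B.mkContinuous₂ (‖π‖ * C) fun f x => ?_, fun f x => rfl⟩
  change ‖∫ r, π (f r) (U r x) ∂μ‖ ≤ _
  calc ‖∫ r, π (f r) (U r x) ∂μ‖ ≤ ∫ r, (‖π‖ * C * ‖x‖) * (‖f r‖ * (ω r : ℝ)) ∂μ := by
        refine norm_integral_le_of_norm_le (f.integrable_norm_mul.const_mul _)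
          (.of_forall fun r => ?_)
        calc ‖π (f r) (U r x)‖ ≤ ‖π‖ * ‖f r‖ * ‖U r x‖ := π.le_opNorm₂ _ _
          _ ≤ ‖π‖ * ‖f r‖ * (C * ω r * ‖x‖) := by
              gcongr
              exact (U r).le_of_opNorm_le (hC r) x
          _ = (‖π‖ * C * ‖x‖) * (‖f r‖ * (ω r : ℝ)) := by ring
    _ = ‖π‖ * C * ‖f‖ * ‖x‖ := by
        rw [integral_const_mul, WeightedCc.norm_def]; ring

variable {α : DynamicalSystem 𝕜 G A} {π : A →L[𝕜] X →L[𝕜] X} {U : G → X →L[𝕜] X}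
  {T : WeightedCc A μ ω →L[𝕜] X →L[𝕜] X}

theorem IsIntegratedOnCc.leftMul [CompleteSpace X] (hT : IsIntegratedOnCc π U T)
    (h : IsCovariantRep α π U) (a : A) (f : WeightedCc A μ ω) (x : X) :
    T (leftMul 𝕜 μ ω a f) x = π a (T f x) := by
  rw [hT, hT, ← (π a).integral_comp_comm (integrable_integratedForm π h.continuous f x)]
  simp [h.map_mul]

theorem IsCovariantRep.inv_mul_cancel (h : IsCovariantRep α π U) (r : G) : U r⁻¹ * U r = 1 := by
  rw [← h.group_mul, _root_.inv_mul_cancel, h.group_one]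

theorem IsCovariantRep.covariant_apply (h : IsCovariantRep α π U) (a : A) (r : G) (x : X) :
    U r (π a x) = π (α.act r a) (U r x) := by
  rw [← h.covariant]
  have := DFunLike.congr_fun (h.inv_mul_cancel r) x
  simp only [mul_apply_eq_comp, one_apply_eq_self] at this
  simp [this]

/-- U_t passes under the integral, covariance moves it past π(f(r)), and the substitution r ↦ t r is
free by left invariance. -/
theorem IsIntegratedOnCc.translate [CompleteSpace X] (hT : IsIntegratedOnCc π U T)
    (h : IsCovariantRep α π U) (t : G) (f : WeightedCc A μ ω) (x : X) :
    T (α.translate μ ω t f) x = U t (T f x) := by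
  rw [hT, hT, ← (U t).integral_comp_comm (integrable_integratedForm π h.continuous f x),
    ← integral_mul_left_eq_self (fun r => π (α.translate μ ω t f r) (U r x)) t]
  simp [h.covariant_apply, h.group_mul]

/-- Each integrand T(f(r) · translate of g by r)x equals π(f(r)) U_r T(g)x, whose integral is
T(f)T(g)x. -/
theorem IsIntegratedOnCc.map_conv [CompleteSpace X] (hT : IsIntegratedOnCc π U T)
    (h : IsCovariantRep α π U) (hα : α.UniformlyBounded) (f g : WeightedCc A μ ω) :
    T (α.conv μ ω hα f g) = T f * T g := by
  ext x
  have := α.map_conv_eq_integral hα ((ContinuousLinearMap.apply 𝕜 X x).comp T) f g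
  simp only [ContinuousLinearMap.comp_apply, ContinuousLinearMap.apply_apply] at this
  rw [this, mul_apply_eq_comp, hT f]
  simp [hT.leftMul h, hT.translate h]

/-- T(φ ⊗ a)x averages π(a)U_r x against φ, so bumps near the identity approximate π(a)x. -/
theorem IsIntegratedOnCc.isNondegenerate [CompleteSpace X] (hT : IsIntegratedOnCc π U T)
    (h : IsCovariantRep α π U) : IsNondegenerate T := by
  refine dense_iff_closure_eq.2 (Set.eq_univ_of_univ_subset ?_)
  rw [← h.nondegenerate.closure_eq]
  refine closure_minimal ?_ isClosed_closure
  change Submodule.span 𝕜 _ ≤ (Submodule.span 𝕜 _).topologicalClosure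
  refine Submodule.span_le.2 ?_
  rintro _ ⟨a, x, rfl⟩
  refine Metric.mem_closure_iff.2 fun ε hε => ?_
  have hc : Continuous fun r => π a (U r x) := (π a).continuous.comp (h.continuous x)
  have hV : {r | ‖π a (U r x) - π a x‖ ≤ ε / 2} ∈ 𝓝 (1 : G) := by
    have h1 : Tendsto (fun r => π a (U r x) - π a x) (𝓝 1) (𝓝 0) := by
      simpa [h.group_one] using (hc.tendsto 1).sub (tendsto_const_nhds (x := π a x))
    filter_upwards [h1.norm.eventually (gt_mem_nhds (norm_zero.trans_lt (half_pos hε)))] with r hr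
    exact hr.le
  obtain ⟨φ, hφ⟩ := exists_isBump μ _ hV
  refine ⟨T (hφ.tensor 𝕜 ω a) x, Submodule.subset_span ⟨_, _, rfl⟩, ?_⟩
  rw [dist_comm, dist_eq_norm, hT]
  simp only [IsBump.tensor, WeightedCc.mk_apply, map_smul, smul_apply]
  exact (hφ.norm_integral_sub_le hc fun r hr => hr).trans_lt (half_lt_self hε)

/-- The covariant representation is determined by its integrated form. -/
theorem IsIntegratedOnCc.unique [CompleteSpace X] {π' : A →L[𝕜] X →L[𝕜] X} {U' : G → X →L[𝕜] X}
    (hT : IsIntegratedOnCc π U T) (h : IsCovariantRep α π U)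
    (hT' : IsIntegratedOnCc π' U' T) (h' : IsCovariantRep α π' U') : π' = π ∧ U' = U := by
  have hn := hT.isNondegenerate h
  refine ⟨ContinuousLinearMap.ext fun a => hn.ext fun f x => ?_, funext fun r => hn.ext fun f x => ?_⟩
  · rw [← hT.leftMul h, hT'.leftMul h']
  · rw [← hT.translate h, hT'.translate h']

/-- Every non-degenerate representation of `C_c(G, A)` is an integrated form. -/
theorem DynamicalSystem.exists_isIntegratedOnCc [CompleteSpace X] (α : DynamicalSystem 𝕜 G A)
    (hα : α.UniformlyBounded) (hA : HasBoundedApproxIdentity A)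
    (hmul : ∀ f g, T (α.conv μ ω hα f g) = T f * T g) (hT : IsNondegenerate T) :
    ∃ (π : A →L[𝕜] X →L[𝕜] X) (U : G → X →L[𝕜] X), IsCovariantRep α π U ∧ WeightBounded U ω ∧
      IsIntegratedOnCc π U T := by
  obtain ⟨π, U, h, hω, hπ, hU⟩ := α.exists_covariantRep hα hA hmul hT
  obtain ⟨T', hT'⟩ := BeurlingBimodule.exists_isIntegratedOnCc (μ := μ) π h.continuous hω
  suffices h' : T' = T from ⟨π, U, h, hω, h' ▸ hT'⟩
  -- On the vector T(g)x, both operators give ∫ T(f(r) · translate of g by r)x dμ(r) = T(f * g)x.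
  refine ContinuousLinearMap.ext fun f => hT.ext fun g x => ?_
  have := α.map_conv_eq_integral hα ((ContinuousLinearMap.apply 𝕜 X x).comp T) f g
  simp only [ContinuousLinearMap.comp_apply, ContinuousLinearMap.apply_apply] at this
  rw [hT', ← mul_apply_eq_comp, ← hmul, this]
  simp [hπ, hU]

/-- An operator commutes with the integrated form iff it commutes with the covariant
representation. -/
theorem IsIntegratedOnCc.commute_iff [CompleteSpace X] (hT : IsIntegratedOnCc π U T)
    (h : IsCovariantRep α π U) (S : X →L[𝕜] X) :
    (∀ f, S * T f = T f * S) ↔ (∀ a, S * π a = π a * S) ∧ ∀ r, S * U r = U r * S := by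
  have hn := hT.isNondegenerate h
  refine ⟨fun hS => ⟨fun a => hn.ext fun f x => ?_, fun r => hn.ext fun f x => ?_⟩,
    fun ⟨hπ, hU⟩ f => ?_⟩
  -- On vectors T(f)x: S π(a)T(f)x = S T(af)x = T(af)Sx = π(a)T(f)Sx = π(a)S T(f)x.
  · have e1 : ∀ g y, S (T g y) = T g (S y) := fun g => DFunLike.congr_fun (hS g)
    simp only [mul_apply_eq_comp, e1, ← hT.leftMul h]
  · have e1 : ∀ g y, S (T g y) = T g (S y) := fun g => DFunLike.congr_fun (hS g)
    simp only [mul_apply_eq_comp, e1, ← hT.translate h]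
  · ext x
    have e1 : ∀ a y, S (π a y) = π a (S y) := fun a => DFunLike.congr_fun (hπ a)
    have e2 : ∀ r y, S (U r y) = U r (S y) := fun r => DFunLike.congr_fun (hU r)
    rw [mul_apply_eq_comp, mul_apply_eq_comp, hT, hT,
      ← S.integral_comp_comm (integrable_integratedForm π h.continuous f x)]
    simp [e1, e2]

end IntegratedForm

/-! ### Inversion and the modular function -/

section Modular

open Measure

variable {G : Type*} [Group G] [TopologicalSpace G] [IsTopologicalGroup G] [LocallyCompactSpace G]
  [T2Space G] [MeasurableSpace G] [BorelSpace G] (μ : Measure G) [μ.IsHaarMeasure] [μ.Regular]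

theorem map_mul_right_eq_modularCharacterFun_smul (g : G) :
    map (· * g) μ = modularCharacterFun g • μ := by
  have : (map (· * g) μ).Regular := Regular.map (Homeomorph.mulRight g)
  rw [modularCharacterFun_eq_haarScalarFactor μ g]
  exact isMulLeftInvariant_eq_smul_of_regular _ μ

/-- Δ(g) is the quotient of ∫ f(yg) dμ(y) by ∫ f. Written against the reflected measure, the
numerator is a convolution-type integral, continuous in g. -/
theorem continuous_modularCharacterFun : Continuous (modularCharacterFun : G → ℝ≥0) := by
  let μ : Measure G := haar
  obtain ⟨⟨f, hf⟩, hfs, hf0, hf1⟩ :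
    ∃ f : C(G, ℝ), HasCompactSupport f ∧ 0 ≤ f ∧ f 1 ≠ 0 := exists_continuous_nonneg_pos 1
  have hpos : ∫ x, f x ∂μ ≠ 0 :=
    (hf.integral_pos_of_hasCompactSupport_nonneg_nonzero hfs hf0 hf1).ne'
  rw [NNReal.isEmbedding_coe.continuous_iff]
  have h : (fun g : G => (modularCharacterFun g : ℝ)) =
      fun g => (∫ y, f (y⁻¹ * g) ∂μ.inv) / ∫ x, f x ∂μ := by
    ext g
    have h0 : ∫ y, f (y⁻¹ * g) ∂μ.inv = ∫ y, f (y * g) ∂μ :=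
      (integral_map_equiv (MeasurableEquiv.inv G) fun y => f (y⁻¹ * g)).trans (by simp)
    rw [eq_div_iff hpos, h0]
    have h1 := integral_map (μ := μ) (φ := (· * g)) (measurable_mul_const g).aemeasurable
      (f := f) hf.aestronglyMeasurable
    rw [map_mul_right_eq_modularCharacterFun_smul, integral_smul_nnreal_measure] at h1
    simpa [NNReal.smul_def] using h1
  change Continuous fun g : G => (modularCharacterFun g : ℝ)
  rw [h]
  exact (continuous_integral_apply_inv_mul hf hfs).div_const _

/-- The image under inversion of the right Haar measure `Δ dμ`. -/
def invModular : Measure G :=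
  (μ.withDensity fun s => (modularCharacterFun s : ENNReal)).map (MeasurableEquiv.inv G)

theorem lintegral_invModular {F : G → ENNReal} (hF : Measurable F) :
    ∫⁻ s, F s ∂invModular μ = ∫⁻ s, modularCharacterFun s * F s⁻¹ ∂μ := by
  rw [invModular, lintegral_map_equiv]
  exact lintegral_withDensity_eq_lintegral_mul μ
    continuous_modularCharacterFun.measurable.coe_nnreal_ennreal (hF.comp measurable_inv)

theorem integral_invModular {E : Type*} [NormedAddCommGroup E] [NormedSpace ℝ E] (F : G → E) :
    ∫ s, F s ∂invModular μ = ∫ s, (modularCharacterFun s : ℝ) • F s⁻¹ ∂μ := by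
  rw [invModular, integral_map_equiv, integral_withDensity_eq_integral_smul
    continuous_modularCharacterFun.measurable]
  rfl

instance : (invModular μ).IsMulLeftInvariant := by
  refine ⟨fun t => Measure.ext_of_lintegral _ fun F hF => ?_⟩
  rw [lintegral_map hF (measurable_const_mul t), lintegral_invModular μ hF,
    lintegral_invModular μ (F := fun s => F (t * s)) (hF.comp (measurable_const_mul t))]
  have hm : Measurable fun s : G => (modularCharacterFun s : ENNReal) * F (t * s⁻¹) :=
    continuous_modularCharacterFun.measurable.coe_nnreal_ennreal.mul
      (hF.comp ((measurable_const_mul t).comp measurable_inv))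
  have h1 := lintegral_map (μ := μ) hm (measurable_mul_const t)
  rw [map_mul_right_eq_modularCharacterFun_smul, lintegral_smul_measure] at h1
  have h2 : ∀ u : G, (modularCharacterFun (u * t) : ENNReal) * F (t * (u * t)⁻¹) =
      modularCharacterFun t * (modularCharacterFun u * F u⁻¹) := fun u => by
    rw [modularCharacterFun_map_mul, mul_inv_rev, mul_inv_cancel_left, ENNReal.coe_mul]
    ring
  simp only [h2] at h1
  rw [lintegral_const_mul' _ _ ENNReal.coe_ne_top, ENNReal.smul_def, smul_eq_mul] at h1
  exact (ENNReal.mul_right_inj (by simpa using (modularCharacterFun_pos t).ne')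
    ENNReal.coe_ne_top).1 h1

instance : IsFiniteMeasureOnCompacts (invModular μ) := by
  have := IsLocallyFiniteMeasure.withDensity_coe (μ := μ)
    (continuous_modularCharacterFun (G := G))
  exact IsFiniteMeasureOnCompacts.map _ (Homeomorph.inv G)

/-- The substitution f ↦ Δ(s) f(s⁻¹) is an involution that multiplies integrals by the factor c, so
c² = 1, and c ≥ 0. -/
theorem haarScalarFactor_invModular : haarScalarFactor (invModular μ) μ = 1 := by
  obtain ⟨⟨f, hf⟩, hfs, hf0, hf1⟩ :
    ∃ f : C(G, ℝ), HasCompactSupport f ∧ 0 ≤ f ∧ f 1 ≠ 0 := exists_continuous_nonneg_pos 1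
  have hpos : ∫ x, f x ∂μ ≠ 0 :=
    (hf.integral_pos_of_hasCompactSupport_nonneg_nonzero hfs hf0 hf1).ne'
  set c := haarScalarFactor (invModular μ) μ
  have key : ∀ φ : G → ℝ, Continuous φ → HasCompactSupport φ →
      ∫ s, (modularCharacterFun s : ℝ) * φ s⁻¹ ∂μ = c * ∫ s, φ s ∂μ := fun φ hφ hφs => by
    have := integral_isMulLeftInvariant_eq_smul_of_hasCompactSupport (invModular μ) μ hφ hφs
    rw [integral_invModular, integral_smul_nnreal_measure] at this
    simpa [NNReal.smul_def] using this
  have hfi : HasCompactSupport fun s => f s⁻¹ := hfs.comp_homeomorph (Homeomorph.inv G)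
  have h1 := key f hf hfs
  have h2 := key (fun s => (modularCharacterFun s : ℝ) * f s⁻¹)
    ((NNReal.continuous_coe.comp continuous_modularCharacterFun).mul (hf.comp continuous_inv))
    hfi.mul_left
  have h3 : ∀ s : G, (modularCharacterFun s : ℝ) * ((modularCharacterFun s⁻¹ : ℝ) * f s⁻¹⁻¹) =
      f s := fun s => by
    rw [← mul_assoc, ← NNReal.coe_mul, ← modularCharacterFun_map_mul, mul_inv_cancel,
      modularCharacterFun_map_one, NNReal.coe_one, one_mul, inv_inv]
  simp only [h3] at h2
  rw [h1, ← mul_assoc] at h2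
  have h4 : (c : ℝ) * c = 1 := mul_right_cancel₀ hpos (by rw [one_mul]; exact h2.symm)
  have h5 : c * c = 1 := by exact_mod_cast h4
  exact (pow_eq_one_iff_of_nonneg zero_le two_ne_zero).1 (by rwa [sq])

/-- Substituting `s⁻¹` for `s` introduces the modular function. -/
theorem integral_modularCharacterFun_smul_inv {E : Type*} [NormedAddCommGroup E] [NormedSpace ℝ E]
    {F : G → E} (hF : HasCompactSupport F) :
    ∫ s, (modularCharacterFun s : ℝ) • F s⁻¹ ∂μ = ∫ s, F s ∂μ := by
  have hK : MeasurableSet (tsupport F) := (isClosed_tsupport F).measurableSet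
  -- The uniqueness of Haar measure used here compares sets with compact closure, hence the
  -- restriction to the support.
  have hres : (invModular μ).restrict (tsupport F) = μ.restrict (tsupport F) := by
    ext E hE
    rw [restrict_apply hE, restrict_apply hE,
      measure_isMulInvariant_eq_smul_of_isCompact_closure (invModular μ) μ
        (hF.isCompact.closure_of_subset Set.inter_subset_right),
      haarScalarFactor_invModular, one_smul]
  have hz : ∀ s, s ∉ tsupport F → F s = 0 := fun s => image_eq_zero_of_notMem_tsupport
  rw [← integral_invModular, ← setIntegral_eq_integral_of_forall_compl_eq_zero hz, hres,
    setIntegral_eq_integral_of_forall_compl_eq_zero hz]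

end Modular

open MulOpposite Measure

/-! ### Passing to the opposite algebra -/

/-- Left and right exchange roles: the left approximate identity of the opposite algebra is the
right one of the original. -/
theorem HasBoundedApproxIdentity.opposite {A : Type*} [NonUnitalNormedRing A]
    (hA : HasBoundedApproxIdentity A) :
    HasBoundedApproxIdentity Aᵐᵒᵖ := by
  obtain ⟨l, hl, M, hM⟩ := hA
  have := hl.neBot
  refine ⟨map op l, ⟨fun m => ?_, fun m => ?_⟩, M, eventually_map.2 hM⟩
  · rw [tendsto_map'_iff]
    exact (continuous_op.tendsto _).comp (hl.tendsto_mul_right (unop m))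
  · rw [tendsto_map'_iff]
    exact (continuous_op.tendsto _).comp (hl.tendsto_mul_left (unop m))

section Opposite

variable (𝕜 A : Type*) [RCLike 𝕜] [NonUnitalNormedRing A] [NormedSpace 𝕜 A]

/-- `op` as a bounded operator. -/
def opL : A →L[𝕜] Aᵐᵒᵖ := (opContinuousLinearEquiv 𝕜 : A ≃L[𝕜] Aᵐᵒᵖ)

/-- `unop` as a bounded operator. -/
def unopL : Aᵐᵒᵖ →L[𝕜] A := ((opContinuousLinearEquiv 𝕜 : A ≃L[𝕜] Aᵐᵒᵖ).symm : Aᵐᵒᵖ →L[𝕜] A)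

variable {𝕜 A}

@[simp] theorem opL_apply (a : A) : opL 𝕜 A a = op a := rfl

@[simp] theorem unopL_apply (a : Aᵐᵒᵖ) : unopL 𝕜 A a = unop a := rfl

/-- The system `(Aᵒᵖ, G, α)`. -/
def DynamicalSystem.opposite {G : Type*} [Group G] [TopologicalSpace G]
    (α : DynamicalSystem 𝕜 G A) : DynamicalSystem 𝕜 G Aᵐᵒᵖ where
  act :=
    { toFun := fun r => (opL 𝕜 A).comp ((α.act r).comp (unopL 𝕜 A))
      map_one' := by ext; simp
      map_mul' := fun r s => by ext; simp }
  act_mul r a b := by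
    change op (α.act r (unop b * unop a)) = op (α.act r (unop a)) * op (α.act r (unop b))
    rw [α.act_mul, op_mul]
  continuous_act a := (opL 𝕜 A).continuous.comp (α.continuous_act (unop a))

@[simp] theorem DynamicalSystem.opposite_act {G : Type*} [Group G] [TopologicalSpace G]
    (α : DynamicalSystem 𝕜 G A) (r : G) (a : Aᵐᵒᵖ) :
    α.opposite.act r a = op (α.act r (unop a)) := rfl

theorem DynamicalSystem.UniformlyBounded.opposite {G : Type*} [Group G] [TopologicalSpace G]
    {α : DynamicalSystem 𝕜 G A} (hα : α.UniformlyBounded) : α.opposite.UniformlyBounded := by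
  obtain ⟨C, hC⟩ := hα
  refine ⟨C, fun r => ContinuousLinearMap.opNorm_le_bound _ ((norm_nonneg _).trans (hC r))
    fun a => ?_⟩
  rw [DynamicalSystem.opposite_act, norm_op, ← norm_unop a]
  exact (α.act r).le_of_opNorm_le (hC r) _

end Opposite

/-- The weight `s ↦ ω(s⁻¹)`. -/
def Weight.inv {G : Type*} [Group G] [TopologicalSpace G] [IsTopologicalGroup G]
    [MeasurableSpace G] [BorelSpace G] (ω : Weight G) : Weight G where
  toFun s := ω s⁻¹
  measurable_toFun := ω.measurable_toFun.comp measurable_inv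
  toFun_ne_zero h := (ω.pos 1).ne' (by simpa using congr_fun h 1)
  toFun_mul_le r s := by
    rw [mul_inv_rev, mul_comm]
    exact ω.toFun_mul_le _ _

/-! ### Reflection with the modular function -/

section Reflect

variable {𝕜 G A B : Type*} [RCLike 𝕜]
  [Group G] [TopologicalSpace G] [IsTopologicalGroup G] [LocallyCompactSpace G] [T2Space G]
  [MeasurableSpace G] [BorelSpace G] [NormedAddCommGroup A] [NormedSpace 𝕜 A]
  [NormedAddCommGroup B] [NormedSpace 𝕜 B]
  (μ : Measure G) [μ.IsHaarMeasure] [μ.Regular] (ω ω' : Weight G)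

variable (𝕜) in
/-- The modular function with values in `𝕜`. -/
def modular (s : G) : 𝕜 := ((modularCharacterFun s : ℝ) : 𝕜)

theorem continuous_modular : Continuous (modular 𝕜 : G → 𝕜) :=
  RCLike.continuous_ofReal.comp (NNReal.continuous_coe.comp continuous_modularCharacterFun)

theorem modular_mul (r s : G) : modular 𝕜 (r * s) = modular 𝕜 r * modular 𝕜 s := by
  simp [modular, modularCharacterFun_map_mul]

theorem modular_mul_inv (s : G) : modular 𝕜 s * modular 𝕜 s⁻¹ = 1 := by
  rw [← modular_mul, mul_inv_cancel]
  simp [modular, modularCharacterFun_map_one]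

/-- The reflection `f ↦ (s ↦ Δ(s) θ_s(f(s⁻¹)))` for a strongly continuous bounded family `θ`. -/
def reflect (θ : G → A →L[𝕜] B) (hθ : Continuous fun p : G × A => θ p.1 p.2) {C : ℝ}
    (hC : ∀ s, ‖θ s‖ ≤ C) (hω : ∀ s, ω' s = ω s⁻¹) : WeightedCc A μ ω →L[𝕜] WeightedCc B μ ω' :=
  LinearMap.mkContinuous
    { toFun := fun f => WeightedCc.mk μ ω' (fun s => modular 𝕜 s • θ s (f s⁻¹))
        (continuous_modular.smul
          (hθ.comp (continuous_id.prodMk (f.continuous.comp continuous_inv))))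
        ((f.hasCompactSupport.comp_homeomorph (Homeomorph.inv G)).mono fun s hs h => hs (by
          have : f s⁻¹ = 0 := h
          simp [this]))
      map_add' := fun f g => WeightedCc.ext fun s => by
        change modular 𝕜 s • θ s (f s⁻¹ + g s⁻¹) =
          modular 𝕜 s • θ s (f s⁻¹) + modular 𝕜 s • θ s (g s⁻¹)
        rw [map_add, smul_add]
      map_smul' := fun c f => WeightedCc.ext fun s => by
        change modular 𝕜 s • θ s (c • f s⁻¹) = c • modular 𝕜 s • θ s (f s⁻¹)
        rw [map_smul, smul_comm] }
    C fun f => by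
      -- The factor Δ(s) in the reflection is the one that the substitution s ↦ s⁻¹ produces, so
      -- only the bound C on θ is lost.
      have hs : HasCompactSupport fun s => ‖f s‖ * (ω s : ℝ) := f.hasCompactSupport.norm.mul_right
      have hi : Integrable (fun s => (modularCharacterFun s : ℝ) * (‖f s⁻¹‖ * ω s⁻¹)) μ := by
        have := ω.inv.integrable_mul μ (fun s => (modularCharacterFun s : ℝ) * ‖f s⁻¹‖)
          ((NNReal.continuous_coe.comp continuous_modularCharacterFun).mul
            (f.continuous.comp continuous_inv).norm)
          (f.hasCompactSupport.comp_homeomorph (Homeomorph.inv G)).norm.mul_left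
        exact this.congr (.of_forall fun s => mul_assoc _ _ _)
      rw [WeightedCc.norm_def, WeightedCc.norm_def,
        ← integral_modularCharacterFun_smul_inv μ hs, ← integral_const_mul]
      refine integral_mono (WeightedCc.integrable_norm_mul _) (hi.const_mul C) fun s => ?_
      change ‖modular 𝕜 s • θ s (f s⁻¹)‖ * (ω' s : ℝ) ≤
        C * ((modularCharacterFun s : ℝ) * (‖f s⁻¹‖ * ω s⁻¹))
      rw [norm_smul, modular, RCLike.norm_ofReal, abs_of_nonneg (NNReal.coe_nonneg _), hω]
      calc (modularCharacterFun s : ℝ) * ‖θ s (f s⁻¹)‖ * ω s⁻¹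
          ≤ (modularCharacterFun s : ℝ) * (C * ‖f s⁻¹‖) * ω s⁻¹ := by
            gcongr
            exact (θ s).le_of_opNorm_le (hC s) _
        _ = _ := by ring

end Reflect

/-! ### The anti-isomorphism with the opposite convolution algebra -/

section Flat

variable {𝕜 G A : Type*} [RCLike 𝕜]
  [Group G] [TopologicalSpace G] [IsTopologicalGroup G] [LocallyCompactSpace G] [T2Space G]
  [MeasurableSpace G] [BorelSpace G]
  [NonUnitalNormedRing A] [NormedSpace ℝ A] [NormedSpace 𝕜 A] [IsScalarTower ℝ 𝕜 A]
  [IsScalarTower 𝕜 A A] [SMulCommClass 𝕜 A A] [CompleteSpace A]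
  (μ : Measure G) [μ.IsHaarMeasure] [μ.Regular] (ω : Weight G)

namespace DynamicalSystem

variable (α : DynamicalSystem 𝕜 G A) (hα : α.UniformlyBounded)

/-- The anti-isomorphism `f ↦ (s ↦ Δ(s) α_s(f(s⁻¹)))` from `C_c(G, A)` to `C_c(G, Aᵒᵖ)`. -/
def flat : WeightedCc A μ ω →L[𝕜] WeightedCc Aᵐᵒᵖ μ ω.inv :=
  reflect μ ω ω.inv (fun s => (opL 𝕜 A).comp (α.act s))
    ((opL 𝕜 A).continuous.comp (α.continuous_uncurry hα)) (C := hα.choose)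
    (fun s => ContinuousLinearMap.opNorm_le_bound _ ((norm_nonneg _).trans (hα.choose_spec s))
      fun a => (α.act s).le_of_opNorm_le (hα.choose_spec s) a) fun _ => rfl

/-- The inverse of `flat`. -/
def sharp : WeightedCc Aᵐᵒᵖ μ ω.inv →L[𝕜] WeightedCc A μ ω :=
  reflect μ ω.inv ω (fun s => (α.act s).comp (unopL 𝕜 A))
    ((α.continuous_uncurry hα).comp
      (continuous_fst.prodMk ((unopL 𝕜 A).continuous.comp continuous_snd))) (C := hα.choose)
    (fun s => ContinuousLinearMap.opNorm_le_bound _ ((norm_nonneg _).trans (hα.choose_spec s))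
      fun a => (α.act s).le_of_opNorm_le (hα.choose_spec s) (unop a))
    fun s => congr_arg ω (inv_inv s).symm

theorem flat_apply (f : WeightedCc A μ ω) (s : G) :
    α.flat μ ω hα f s = modular 𝕜 s • op (α.act s (f s⁻¹)) := rfl

theorem sharp_apply (f : WeightedCc Aᵐᵒᵖ μ ω.inv) (s : G) :
    α.sharp μ ω hα f s = modular 𝕜 s • α.act s (unop (f s⁻¹)) := rfl

theorem flat_sharp (f : WeightedCc Aᵐᵒᵖ μ ω.inv) : α.flat μ ω hα (α.sharp μ ω hα f) = f :=
  WeightedCc.ext fun s => by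
    rw [flat_apply, sharp_apply, map_smul, op_smul, smul_smul, modular_mul_inv, one_smul]
    simp

theorem sharp_flat (f : WeightedCc A μ ω) : α.sharp μ ω hα (α.flat μ ω hα f) = f :=
  WeightedCc.ext fun s => by
    rw [sharp_apply, flat_apply, unop_smul, map_smul, smul_smul, modular_mul_inv, one_smul]
    simp

/-- After r ↦ s⁻¹ r the left integrand is Δ(s) α_s(f(s⁻¹ r)) α_r(g(r⁻¹)). Splitting Δ(s) = Δ(r)Δ(r⁻¹
s) makes it the opposite product of the two reflected factors. -/
theorem flat_conv (f g : WeightedCc A μ ω) :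
    α.flat μ ω hα (α.conv μ ω hα f g) =
      α.opposite.conv μ ω.inv hα.opposite (α.flat μ ω hα g) (α.flat μ ω hα f) := by
  refine WeightedCc.ext fun s => ?_
  have h1 := ((opL 𝕜 A).comp (α.act s)).integral_comp_comm
    (α.integrable_twist μ hα f.continuous f.hasCompactSupport g.continuous s⁻¹)
  rw [ContinuousLinearMap.comp_apply, opL_apply] at h1
  rw [flat_apply, conv_apply, conv_apply, ← h1, ← integral_smul,
    ← integral_mul_left_eq_self _ s⁻¹]
  refine integral_congr_ae (.of_forall fun r => ?_)
  simp only [flat_apply, opposite_act, ContinuousLinearMap.comp_apply, opL_apply,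
    unop_op, map_smul, smul_mul_smul_comm, ← modular_mul, mul_inv_rev, inv_inv, α.act_mul,
    ← act_mul_apply, op_mul, mul_inv_cancel_left, mul_inv_cancel_right]

theorem sharp_conv (f g : WeightedCc Aᵐᵒᵖ μ ω.inv) :
    α.sharp μ ω hα (α.opposite.conv μ ω.inv hα.opposite f g) =
      α.conv μ ω hα (α.sharp μ ω hα g) (α.sharp μ ω hα f) := by
  rw [← α.sharp_flat μ ω hα (α.conv μ ω hα _ _), flat_conv, flat_sharp, flat_sharp]

end DynamicalSystem

end Flat

open MulOpposite Measure

/-! ### Integrated forms of anti-covariant pairs -/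

section Anti

variable {𝕜 G A X : Type*} [RCLike 𝕜]
  [Group G] [TopologicalSpace G] [IsTopologicalGroup G] [LocallyCompactSpace G] [T2Space G]
  [MeasurableSpace G] [BorelSpace G]
  [NonUnitalNormedRing A] [NormedSpace ℝ A] [NormedSpace 𝕜 A] [IsScalarTower ℝ 𝕜 A]
  [IsScalarTower 𝕜 A A] [SMulCommClass 𝕜 A A] [CompleteSpace A]
  [NormedAddCommGroup X] [NormedSpace ℝ X] [NormedSpace 𝕜 X] [IsScalarTower ℝ 𝕜 X]
  {μ : Measure G} [μ.IsHaarMeasure] [μ.Regular] {ω : Weight G}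

/-- `T(f) = ∫ U_r π(f(r)) dμ(r)` for `f ∈ C_c(G, A)`, where `T` is defined on `C_c(G, A)` only. -/
def IsAntiIntegratedOnCc (π : A →L[𝕜] X →L[𝕜] X) (U : G → X →L[𝕜] X)
    (T : WeightedCc A μ ω →L[𝕜] X →L[𝕜] X) : Prop :=
  ∀ (f : WeightedCc A μ ω) (x : X), T f x = ∫ r, U r (π (f r) x) ∂μ

variable {α : DynamicalSystem 𝕜 G A} {π : A →L[𝕜] X →L[𝕜] X} {U : G → X →L[𝕜] X}
  {T : WeightedCc A μ ω →L[𝕜] X →L[𝕜] X}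

theorem isNondegenerate_comp_iff {E F : Type*} [NormedAddCommGroup E] [NormedSpace 𝕜 E]
    [NormedAddCommGroup F] [NormedSpace 𝕜 F] {S : F →L[𝕜] X →L[𝕜] X} {L : E →L[𝕜] F}
    (hL : Function.Surjective L) : IsNondegenerate (S.comp L) ↔ IsNondegenerate S := by
  have : {y : X | ∃ (e : E) (x : X), S.comp L e x = y} = {y : X | ∃ (e : F) (x : X), S e x = y} := by
    ext y
    exact ⟨fun ⟨e, x, h⟩ => ⟨L e, x, h⟩, fun ⟨e, x, h⟩ => by
      obtain ⟨e, rfl⟩ := hL e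
      exact ⟨e, x, h⟩⟩
  rw [IsNondegenerate, IsNondegenerate, this]

/-- Inversion turns an anti-representation of `G` into a representation, and the opposite algebra
does the same for `A`; anti-covariance at r⁻¹ is covariance at r. -/
theorem isAntiCovariantPair_iff :
    IsAntiCovariantPair α π U ↔
      IsCovariantRep α.opposite (π.comp (unopL 𝕜 A)) fun r => U r⁻¹ := by
  have hs : Function.Surjective (unopL 𝕜 A) := unop_surjective
  constructor
  · intro h
    refine ⟨fun a b => h.map_mul _ _, (isNondegenerate_comp_iff hs).2 h.nondegenerate, ?_,
      fun r s => ?_, fun x => (h.continuous x).comp continuous_inv, fun a r => ?_⟩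
    · simpa using h.group_one
    · rw [mul_inv_rev]; exact h.group_mul _ _
    · simpa using h.anticovariant (unop a) r⁻¹
  · intro h
    refine ⟨fun a b => h.map_mul (op b) (op a), (isNondegenerate_comp_iff hs).1 h.nondegenerate, ?_,
      fun r s => ?_, fun x => ?_, fun a r => ?_⟩
    · simpa using h.group_one
    · simpa using h.group_mul s⁻¹ r⁻¹
    · simpa [Function.comp_def] using (h.continuous x).comp continuous_inv
    · simpa using h.covariant (op a) r⁻¹

theorem weightBounded_inv_iff : WeightBounded (fun r => U r⁻¹) ω.inv ↔ WeightBounded U ω :=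
  ⟨fun ⟨C, hC⟩ => ⟨C, fun r => by simpa [Weight.inv] using hC r⁻¹⟩,
    fun ⟨C, hC⟩ => ⟨C, fun r => hC r⁻¹⟩⟩

theorem IsAntiCovariantPair.anticovariant_apply (h : IsAntiCovariantPair α π U) (a : A) (r : G)
    (x : X) : U r (π a x) = π (α.act r⁻¹ a) (U r x) := by
  simpa using (isAntiCovariantPair_iff.1 h).covariant_apply (op a) r⁻¹ x

/-- Anti-covariance rewrites U_r π(f(r)) as π(α_{r⁻¹}(f(r))) U_r, and r ↦ r⁻¹ then produces exactly
the reflected function. -/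
theorem IsAntiCovariantPair.integral_eq (h : IsAntiCovariantPair α π U) (hα : α.UniformlyBounded)
    (f : WeightedCc A μ ω) (x : X) :
    ∫ r, U r (π (f r) x) ∂μ =
      ∫ r, (π.comp (unopL 𝕜 A)) (α.flat μ ω hα f r) (U r⁻¹ x) ∂μ := by
  have hs : HasCompactSupport fun r => U r (π (f r) x) :=
    f.hasCompactSupport.mono fun r hr h0 => hr (by simp [h0])
  rw [← integral_modularCharacterFun_smul_inv μ hs]
  refine integral_congr_ae (.of_forall fun r => ?_)
  simp only [h.anticovariant_apply, inv_inv, DynamicalSystem.flat_apply,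
    ContinuousLinearMap.comp_apply, unopL_apply, unop_op, map_smul, modular,
    _root_.smul_apply]
  rw [RCLike.real_smul_eq_coe_smul (K := 𝕜)]

/-- The dictionary through which each result on integrated forms yields its anti-version. -/
theorem IsAntiCovariantPair.isAntiIntegratedOnCc_iff (h : IsAntiCovariantPair α π U)
    (hα : α.UniformlyBounded) :
    IsAntiIntegratedOnCc π U T ↔
      IsIntegratedOnCc (π.comp (unopL 𝕜 A)) (fun r => U r⁻¹) (T.comp (α.sharp μ ω hα)) := by
  constructor
  · intro hT f x
    rw [ContinuousLinearMap.comp_apply, hT, h.integral_eq hα, α.flat_sharp μ ω]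
  · intro hT f x
    rw [h.integral_eq hα, ← hT, ContinuousLinearMap.comp_apply, α.sharp_flat μ ω]

theorem sharp_surjective (hα : α.UniformlyBounded) :
    Function.Surjective (α.sharp μ ω hα) :=
  fun f => ⟨_, α.sharp_flat μ ω hα f⟩

theorem IsAntiCovariantPair.exists_isAntiIntegratedOnCc [CompleteSpace X]
    (h : IsAntiCovariantPair α π U) (hα : α.UniformlyBounded) (hω : WeightBounded U ω) :
    ∃ T : WeightedCc A μ ω →L[𝕜] X →L[𝕜] X, IsAntiIntegratedOnCc π U T := by
  obtain ⟨T, hT⟩ := exists_isIntegratedOnCc (μ := μ) (π.comp (unopL 𝕜 A))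
    (isAntiCovariantPair_iff.1 h).continuous (weightBounded_inv_iff.2 hω)
  refine ⟨T.comp (α.flat μ ω hα), (h.isAntiIntegratedOnCc_iff hα).2 fun f x => ?_⟩
  simp only [ContinuousLinearMap.comp_apply, α.flat_sharp μ ω, hT f x]

theorem IsAntiIntegratedOnCc.map_conv [CompleteSpace X] (hT : IsAntiIntegratedOnCc π U T)
    (h : IsAntiCovariantPair α π U) (hα : α.UniformlyBounded) (f g : WeightedCc A μ ω) :
    T (α.conv μ ω hα f g) = T g * T f := by
  have := ((h.isAntiIntegratedOnCc_iff hα).1 hT).map_conv (isAntiCovariantPair_iff.1 h) hα.opposite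
    (α.flat μ ω hα g) (α.flat μ ω hα f)
  simpa only [← α.flat_conv μ ω, ContinuousLinearMap.comp_apply, α.sharp_flat μ ω] using this

theorem IsAntiIntegratedOnCc.isNondegenerate [CompleteSpace X] (hT : IsAntiIntegratedOnCc π U T)
    (h : IsAntiCovariantPair α π U) (hα : α.UniformlyBounded) : IsNondegenerate T :=
  (isNondegenerate_comp_iff (sharp_surjective hα)).1
    (((h.isAntiIntegratedOnCc_iff hα).1 hT).isNondegenerate (isAntiCovariantPair_iff.1 h))

theorem IsAntiIntegratedOnCc.unique [CompleteSpace X] {π' : A →L[𝕜] X →L[𝕜] X}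
    {U' : G → X →L[𝕜] X} (hT : IsAntiIntegratedOnCc π U T) (h : IsAntiCovariantPair α π U)
    (hT' : IsAntiIntegratedOnCc π' U' T) (h' : IsAntiCovariantPair α π' U')
    (hα : α.UniformlyBounded) : π' = π ∧ U' = U := by
  obtain ⟨h1, h2⟩ := ((h.isAntiIntegratedOnCc_iff hα).1 hT).unique (isAntiCovariantPair_iff.1 h)
    ((h'.isAntiIntegratedOnCc_iff hα).1 hT') (isAntiCovariantPair_iff.1 h')
  refine ⟨ContinuousLinearMap.ext fun a => DFunLike.congr_fun h1 (op a), funext fun r => ?_⟩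
  simpa using congr_fun h2 r⁻¹

theorem DynamicalSystem.exists_isAntiIntegratedOnCc [CompleteSpace X] (α : DynamicalSystem 𝕜 G A)
    (hα : α.UniformlyBounded) (hA : HasBoundedApproxIdentity A)
    (hmul : ∀ f g, T (α.conv μ ω hα f g) = T g * T f) (hT : IsNondegenerate T) :
    ∃ (π : A →L[𝕜] X →L[𝕜] X) (U : G → X →L[𝕜] X), IsAntiCovariantPair α π U ∧ WeightBounded U ω ∧
      IsAntiIntegratedOnCc π U T := by
  obtain ⟨π, U, h, hω, hint⟩ := α.opposite.exists_isIntegratedOnCc hα.opposite hA.opposite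
    (T := T.comp (α.sharp μ ω hα)) (fun f g => by
      simp only [ContinuousLinearMap.comp_apply, α.sharp_conv μ ω, hmul])
    ((isNondegenerate_comp_iff (sharp_surjective hα)).2 hT)
  -- The pair found for the opposite system is carried back; passing to the opposite again returns
  -- it.
  have e1 : (π.comp (opL 𝕜 A)).comp (unopL 𝕜 A) = π := rfl
  have e2 : (fun r => U r⁻¹⁻¹) = U := by simp
  have h' : IsAntiCovariantPair α (π.comp (opL 𝕜 A)) fun r => U r⁻¹ := by
    rw [isAntiCovariantPair_iff, e1, e2]; exact h
  refine ⟨_, _, h', ?_, ?_⟩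
  · rw [← weightBounded_inv_iff, e2]; exact hω
  · rw [h'.isAntiIntegratedOnCc_iff hα, e1, e2]; exact hint

theorem IsAntiIntegratedOnCc.commute_iff [CompleteSpace X] (hT : IsAntiIntegratedOnCc π U T)
    (h : IsAntiCovariantPair α π U) (hα : α.UniformlyBounded) (S : X →L[𝕜] X) :
    (∀ f, S * T f = T f * S) ↔ (∀ a, S * π a = π a * S) ∧ ∀ r, S * U r = U r * S := by
  have key := ((h.isAntiIntegratedOnCc_iff hα).1 hT).commute_iff (isAntiCovariantPair_iff.1 h) S
  constructor
  · intro hS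
    obtain ⟨h1, h2⟩ := key.1 fun f => hS _
    exact ⟨fun a => h1 (op a), fun r => by simpa using h2 r⁻¹⟩
  · rintro ⟨h1, h2⟩ f
    have := key.2 ⟨fun a => h1 (unop a), fun r => h2 r⁻¹⟩ (α.flat μ ω hα f)
    simpa only [ContinuousLinearMap.comp_apply, α.sharp_flat μ ω] using this

end Anti

/-! ### Passing to the completion -/

section Completion

variable {𝕜 G A X : Type*} [RCLike 𝕜]
  [Group G] [TopologicalSpace G] [IsTopologicalGroup G] [LocallyCompactSpace G] [T2Space G]
  [MeasurableSpace G] [BorelSpace G]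
  [NonUnitalNormedRing A] [NormedSpace ℝ A] [NormedSpace 𝕜 A] [IsScalarTower ℝ 𝕜 A]
  [IsScalarTower 𝕜 A A] [SMulCommClass 𝕜 A A] [CompleteSpace A]
  [NormedAddCommGroup X] [NormedSpace 𝕜 X]
  {μ : Measure G} [μ.IsHaarMeasure] [μ.Regular] {ω : Weight G}

variable (𝕜) in
theorem denseRange_ofCc : DenseRange (ofCc μ ω 𝕜 : WeightedCc A μ ω →L[𝕜] BeurlingSpace A μ ω) :=
  UniformSpace.Completion.denseRange_coe

variable (𝕜) in
theorem isUniformInducing_ofCc :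
    IsUniformInducing (ofCc μ ω 𝕜 : WeightedCc A μ ω →L[𝕜] BeurlingSpace A μ ω) :=
  UniformSpace.Completion.isUniformInducing_coe _

/-- A bounded operator on `C_c(G, A)` extends uniquely to the completion. -/
theorem existsUnique_comp_ofCc [CompleteSpace X] (T : WeightedCc A μ ω →L[𝕜] X →L[𝕜] X) :
    ∃! T' : BeurlingSpace A μ ω →L[𝕜] X →L[𝕜] X, T'.comp (ofCc μ ω 𝕜) = T := by
  refine ⟨T.extend (ofCc μ ω 𝕜), ContinuousLinearMap.ext fun f =>
    ContinuousLinearMap.extend_eq _ (denseRange_ofCc 𝕜) (isUniformInducing_ofCc 𝕜) f, fun T' hT' => ?_⟩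
  refine ContinuousLinearMap.ext fun u => DFunLike.congr_fun ?_ u
  refine DFunLike.coe_injective ((denseRange_ofCc 𝕜).equalizer T'.continuous
    (ContinuousLinearMap.continuous _) (funext fun f => ?_))
  rw [Function.comp_apply, Function.comp_apply,
    ContinuousLinearMap.extend_eq _ (denseRange_ofCc 𝕜) (isUniformInducing_ofCc 𝕜), ← hT']
  rfl

theorem isNondegenerate_comp_ofCc_iff {T : BeurlingSpace A μ ω →L[𝕜] X →L[𝕜] X} :
    IsNondegenerate (T.comp (ofCc μ ω 𝕜)) ↔ IsNondegenerate T := by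
  constructor
  · intro h
    refine h.mono (Submodule.span_mono ?_)
    rintro _ ⟨f, x, rfl⟩
    exact ⟨ofCc μ ω 𝕜 f, x, rfl⟩
  · intro h
    refine dense_iff_closure_eq.2 (Set.eq_univ_of_univ_subset ?_)
    rw [← h.closure_eq]
    refine closure_minimal ?_ isClosed_closure
    change Submodule.span 𝕜 _ ≤ (Submodule.span 𝕜 _).topologicalClosure
    refine Submodule.span_le.2 ?_
    rintro _ ⟨u, x, rfl⟩
    have hc : Continuous fun u => T u x := T.continuous.clm_apply continuous_const
    refine map_mem_closure (f := fun u => T u x) hc (denseRange_ofCc 𝕜 u) ?_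
    rintro _ ⟨f, rfl⟩
    exact Submodule.subset_span ⟨f, x, rfl⟩

/-- Multiplicativity is a closed condition on pairs (u, v), so it may be checked on the dense C_c(G,
A). -/
theorem isBeurlingRep_iff {α : DynamicalSystem 𝕜 G A} {hα : α.UniformlyBounded}
    {T : BeurlingSpace A μ ω →L[𝕜] X →L[𝕜] X} :
    IsBeurlingRep α hα T ↔
      (∀ f g, T.comp (ofCc μ ω 𝕜) (α.conv μ ω hα f g) =
        T.comp (ofCc μ ω 𝕜) f * T.comp (ofCc μ ω 𝕜) g) ∧
      IsNondegenerate (T.comp (ofCc μ ω 𝕜)) := by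
  rw [isNondegenerate_comp_ofCc_iff]
  refine ⟨fun h => ⟨fun f g => ?_, h.nondegenerate⟩, fun h => ⟨fun u v => ?_, h.2⟩⟩
  · simp only [ContinuousLinearMap.comp_apply, ← α.beurlingMul_ofCc μ ω, h.map_mul]
  · have hd := denseRange_ofCc 𝕜 (A := A) (μ := μ) (ω := ω)
    refine hd.induction_on₂ (p := fun u v => T (α.beurlingMul μ ω hα u v) = T u * T v)
      (isClosed_eq ?_ ?_) (fun f g => ?_) u v
    · exact T.continuous.comp ((α.beurlingMul μ ω hα).continuous₂)
    · exact (T.continuous.comp continuous_fst).mul (T.continuous.comp continuous_snd)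
    · rw [α.beurlingMul_ofCc μ ω]; exact h.1 f g

theorem isBeurlingAntiRep_iff {α : DynamicalSystem 𝕜 G A} {hα : α.UniformlyBounded}
    {T : BeurlingSpace A μ ω →L[𝕜] X →L[𝕜] X} :
    IsBeurlingAntiRep α hα T ↔
      (∀ f g, T.comp (ofCc μ ω 𝕜) (α.conv μ ω hα f g) =
        T.comp (ofCc μ ω 𝕜) g * T.comp (ofCc μ ω 𝕜) f) ∧
      IsNondegenerate (T.comp (ofCc μ ω 𝕜)) := by
  rw [isNondegenerate_comp_ofCc_iff]
  refine ⟨fun h => ⟨fun f g => ?_, h.nondegenerate⟩, fun h => ⟨fun u v => ?_, h.2⟩⟩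
  · simp only [ContinuousLinearMap.comp_apply, ← α.beurlingMul_ofCc μ ω, h.map_mul]
  · have hd := denseRange_ofCc 𝕜 (A := A) (μ := μ) (ω := ω)
    refine hd.induction_on₂ (p := fun u v => T (α.beurlingMul μ ω hα u v) = T v * T u)
      (isClosed_eq ?_ ?_) (fun f g => ?_) u v
    · exact T.continuous.comp ((α.beurlingMul μ ω hα).continuous₂)
    · exact (T.continuous.comp continuous_snd).mul (T.continuous.comp continuous_fst)
    · rw [α.beurlingMul_ofCc μ ω]; exact h.1 f g

theorem commute_comp_ofCc_iff {T : BeurlingSpace A μ ω →L[𝕜] X →L[𝕜] X} {S : X →L[𝕜] X} :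
    (∀ f, S * T.comp (ofCc μ ω 𝕜) f = T.comp (ofCc μ ω 𝕜) f * S) ↔ ∀ u, S * T u = T u * S := by
  refine ⟨fun h u => ?_, fun h f => h _⟩
  exact (denseRange_ofCc 𝕜 (A := A) (μ := μ) (ω := ω)).induction_on u
    (p := fun u => S * T u = T u * S)
    (isClosed_eq (continuous_const.mul T.continuous) (T.continuous.mul continuous_const)) h

end Completion

end BeurlingBimodule

end

/-! ### Commuting pairs and commuting representations -/

open BeurlingBimodule in
theorem mainTheorem5 {𝕜 G H A B X : Type*} [RCLike 𝕜]
    [Group G] [TopologicalSpace G] [IsTopologicalGroup G] [LocallyCompactSpace G] [T2Space G]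
    [MeasurableSpace G] [BorelSpace G]
    [Group H] [TopologicalSpace H] [IsTopologicalGroup H] [LocallyCompactSpace H] [T2Space H]
    [MeasurableSpace H] [BorelSpace H]
    [NonUnitalNormedRing A] [NormedSpace ℝ A] [NormedSpace 𝕜 A] [IsScalarTower ℝ 𝕜 A]
    [IsScalarTower 𝕜 A A] [SMulCommClass 𝕜 A A] [CompleteSpace A]
    [NonUnitalNormedRing B] [NormedSpace ℝ B] [NormedSpace 𝕜 B] [IsScalarTower ℝ 𝕜 B]
    [IsScalarTower 𝕜 B B] [SMulCommClass 𝕜 B B] [CompleteSpace B]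
    [NormedAddCommGroup X] [NormedSpace ℝ X] [NormedSpace 𝕜 X] [IsScalarTower ℝ 𝕜 X]
    [CompleteSpace X]
    (μG : MeasureTheory.Measure G) [μG.IsHaarMeasure] [μG.Regular]
    (μH : MeasureTheory.Measure H) [μH.IsHaarMeasure] [μH.Regular]
    (α : DynamicalSystem 𝕜 G A) (β : DynamicalSystem 𝕜 H B)
    (hA : HasBoundedApproxIdentity A) (hB : HasBoundedApproxIdentity B)
    (hα : α.UniformlyBounded) (hβ : β.UniformlyBounded)
    (ω : Weight G) (η : Weight H) :
    -- from commuting pairs to commuting representations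
    (∀ (πm : A →L[𝕜] X →L[𝕜] X) (Um : G → X →L[𝕜] X)
        (πa : B →L[𝕜] X →L[𝕜] X) (Ua : H → X →L[𝕜] X),
      IsCovariantRep α πm Um → WeightBounded Um ω →
      IsAntiCovariantPair β πa Ua → WeightBounded Ua η →
      PairsCommute πm Um πa Ua →
      (∃! Tm : BeurlingSpace A μG ω →L[𝕜] X →L[𝕜] X, IsIntegratedForm πm Um Tm) ∧
      (∃! Ta : BeurlingSpace B μH η →L[𝕜] X →L[𝕜] X, IsAntiIntegratedForm πa Ua Ta) ∧
      ∀ (Tm : BeurlingSpace A μG ω →L[𝕜] X →L[𝕜] X)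
        (Ta : BeurlingSpace B μH η →L[𝕜] X →L[𝕜] X),
        IsIntegratedForm πm Um Tm → IsAntiIntegratedForm πa Ua Ta →
        IsBeurlingRep α hα Tm ∧ IsBeurlingAntiRep β hβ Ta ∧ MapsCommute Tm Ta) ∧
    -- every commuting pair of representations arises from unique, necessarily commuting, pairs
    (∀ (Tm : BeurlingSpace A μG ω →L[𝕜] X →L[𝕜] X)
        (Ta : BeurlingSpace B μH η →L[𝕜] X →L[𝕜] X),
      IsBeurlingRep α hα Tm → IsBeurlingAntiRep β hβ Ta → MapsCommute Tm Ta →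
      ∃ (πm : A →L[𝕜] X →L[𝕜] X) (Um : G → X →L[𝕜] X)
        (πa : B →L[𝕜] X →L[𝕜] X) (Ua : H → X →L[𝕜] X),
        IsCovariantRep α πm Um ∧ WeightBounded Um ω ∧ IsIntegratedForm πm Um Tm ∧
        IsAntiCovariantPair β πa Ua ∧ WeightBounded Ua η ∧ IsAntiIntegratedForm πa Ua Ta ∧
        PairsCommute πm Um πa Ua ∧
        (∀ (πm' : A →L[𝕜] X →L[𝕜] X) (Um' : G → X →L[𝕜] X),
          IsCovariantRep α πm' Um' → WeightBounded Um' ω → IsIntegratedForm πm' Um' Tm →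
          πm' = πm ∧ Um' = Um) ∧
        (∀ (πa' : B →L[𝕜] X →L[𝕜] X) (Ua' : H → X →L[𝕜] X),
          IsAntiCovariantPair β πa' Ua' → WeightBounded Ua' η → IsAntiIntegratedForm πa' Ua' Ta →
          πa' = πa ∧ Ua' = Ua)) := by
  constructor
  · intro πm Um πa Ua hm hmω ha haη ⟨hππ, hπU, hUπ, hUU⟩
    obtain ⟨Sm, hSm⟩ := exists_isIntegratedOnCc (μ := μG) πm hm.continuous hmω
    obtain ⟨Sa, hSa⟩ := ha.exists_isAntiIntegratedOnCc (μ := μH) hβ haη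
    have em : ∀ T : BeurlingSpace A μG ω →L[𝕜] X →L[𝕜] X,
        T.comp (ofCc μG ω 𝕜) = Sm ↔ IsIntegratedForm πm Um T := fun T =>
      ⟨fun h f x => by rw [← hSm, ← h]; rfl,
        fun h => by ext f x; exact (h f x).trans (hSm f x).symm⟩
    have ea : ∀ T : BeurlingSpace B μH η →L[𝕜] X →L[𝕜] X,
        T.comp (ofCc μH η 𝕜) = Sa ↔ IsAntiIntegratedForm πa Ua T := fun T =>
      ⟨fun h f x => by rw [← hSa, ← h]; rfl,
        fun h => by ext f x; exact (h f x).trans (hSa f x).symm⟩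
    refine ⟨(existsUnique_congr em).1 (existsUnique_comp_ofCc Sm),
      (existsUnique_congr ea).1 (existsUnique_comp_ofCc Sa), fun Tm Ta hTm hTa => ?_⟩
    have h1 := (em Tm).2 hTm
    have h2 := (ea Ta).2 hTa
    refine ⟨isBeurlingRep_iff.2 ?_, isBeurlingAntiRep_iff.2 ?_, fun u v => ?_⟩
    · rw [h1]
      exact ⟨hSm.map_conv hm hα, hSm.isNondegenerate hm⟩
    · rw [h2]
      exact ⟨hSa.map_conv ha hβ, hSa.isNondegenerate ha hβ⟩
    · refine (commute_comp_ofCc_iff.1 (fun g => ?_) v)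
      rw [h2]
      -- With u fixed, Tm(u) is a single operator to test against (πa, Ua); each πa(b) and Ua(s) is
      -- in turn a single operator to test against (πm, Um).
      refine (hSa.commute_iff ha hβ (Tm u)).2 ⟨fun b => ?_, fun s => ?_⟩ g
      · refine (commute_comp_ofCc_iff.1 (fun f => ?_) u).symm
        rw [h1]
        exact (hSm.commute_iff hm (πa b)).2
          ⟨fun a => (hππ a b).symm, fun r => (hUπ r b).symm⟩ f
      · refine (commute_comp_ofCc_iff.1 (fun f => ?_) u).symm
        rw [h1]
        exact (hSm.commute_iff hm (Ua s)).2
          ⟨fun a => (hπU a s).symm, fun r => (hUU r s).symm⟩ f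
  · intro Tm Ta hTm hTa hcomm
    obtain ⟨hm1, hm2⟩ := isBeurlingRep_iff.1 hTm
    obtain ⟨ha1, ha2⟩ := isBeurlingAntiRep_iff.1 hTa
    obtain ⟨πm, Um, hm, hmω, hSm⟩ := α.exists_isIntegratedOnCc hα hA hm1 hm2
    obtain ⟨πa, Ua, ha, haη, hSa⟩ := β.exists_isAntiIntegratedOnCc hβ hB ha1 ha2
    -- The same two applications of the criterion, read backwards: from Ta to (πa, Ua), then from Tm
    -- to (πm, Um).
    have hTu : ∀ u, (∀ b, Tm u * πa b = πa b * Tm u) ∧ ∀ s, Tm u * Ua s = Ua s * Tm u :=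
      fun u => (hSa.commute_iff ha hβ (Tm u)).1 fun g => hcomm u _
    have hπa := fun b => (hSm.commute_iff hm (πa b)).1 fun f => ((hTu _).1 b).symm
    have hUa := fun s => (hSm.commute_iff hm (Ua s)).1 fun f => ((hTu _).2 s).symm
    exact ⟨πm, Um, πa, Ua, hm, hmω, hSm, ha, haη, hSa,
      ⟨fun a b => ((hπa b).1 a).symm, fun a s => ((hUa s).1 a).symm,
        fun r b => ((hπa b).2 r).symm, fun r s => ((hUa s).2 r).symm⟩,
      fun π' U' h' _ hint => hSm.unique hm hint h',
      fun π' U' h' _ hint => hSa.unique ha hint h' hβ⟩
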